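/- Let $M$ be a Coxeter matrix of finite rank at least $2$ which is irreducible (its Coxeter graph, with an edge between $i\neq j$ whenever $m_{ij}\ge 3$ or $m_{ij}=\infty$, is connected) and of finite type (its Coxeter group is finite). Let $$A=A(M)=\langle s_i \mid \underbrace{s_is_js_i\cdots}_{m_{ij}}=\underbrace{s_js_is_j\cdots}_{m_{ij}},\ i\ne j,\ m_{ij}\ne\infty\rangle$$ be its Artin group and $Z$ the centre of $A$, let $\ell:A\to\mathbb Z$ be the length homomorphism with $\ell(s_i)=1$ for all $i$, and let $\mathrm{Tv}(A)$ be the group of automorphisms of $A$ that are transvections, that is, of the form $x\mapsto x\lambda(x)$ with $\lambda:A\to Z$. The group $Z$ is infinite cyclic. Let $\zeta$ be any generator of $Z$, put $d=\ell(\zeta)$, and let $\bar\ell:A/Z\to\mathbb Z/d\mathbb Z$ be the homomorphism induced by $\ell$. Let $\mathrm{Aut}^*(A)$ be the group of automorphisms $\alpha$ of $A$ with $\ell\circ\alpha=\pm\ell$, and $\mathrm{Aut}^*(A/Z)$ the group of automorphisms $\alpha$ of $A/Z$ with $\bar\ell\circ\alpha=\pm\bar\ell$. Then the natural map $\pi:\mathrm{Aut}^*(A)\to\mathrm{Aut}^*(A/Z)$,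 $\pi(\alpha)(xZ)=\alpha(x)Z$, is an isomorphism. If, in addition, the abelianization of $A$ is infinite cyclic (equivalently, $M$ is not of type $I_2(2m)$ with $m\ge 2$, $B_n$ with $n\ge 2$, or $F_4$), then $\mathrm{Tv}(A)$ is trivial and $\mathrm{Aut}(A)\cong\mathrm{Aut}^*(A/Z)$, the isomorphism being given by the natural map $\alpha\mapsto(xZ\mapsto\alpha(x)Z)$. -/

import Mathlib

/-- The alternating product `a * b * a * ⋯` with `m` factors, starting with `a`. -/
def altProd {G : Type*} [Monoid G] : G → G → ℕ → G
  | _, _, 0 => 1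
  | a, b, m + 1 => a * altProd b a m

theorem map_altProd {G H : Type*} [Monoid G] [Monoid H] (f : G →* H) (a b : G) (m : ℕ) :
    f (altProd a b m) = altProd (f a) (f b) m := by
  induction m generalizing a b with
  | zero => simp [altProd]
  | succ m ih => simp [altProd, ih]

namespace CoxeterMatrix

variable {B : Type*} (M : CoxeterMatrix B)

/-- The braid relators `(s_i s_j s_i ⋯) (s_j s_i s_j ⋯)⁻¹`, with `M i j` letters in each factor,
for `i ≠ j` and `M i j` finite (the value `0` of a Coxeter matrix stands for `∞`). -/
def artinRelators : Set (FreeGroup B) :=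
  {r | ∃ i j : B, i ≠ j ∧ M i j ≠ 0 ∧
    r = altProd (FreeGroup.of i) (FreeGroup.of j) (M i j) *
      (altProd (FreeGroup.of j) (FreeGroup.of i) (M i j))⁻¹}

/-- The Artin group `A(M)`. -/
abbrev ArtinGroup : Type _ := PresentedGroup M.artinRelators

/-- The Coxeter graph: an edge between `i ≠ j` when `M i j ≥ 3` or `M i j = ∞` (encoded by `0`). -/
def coxeterGraph : SimpleGraph B where
  Adj i j := i ≠ j ∧ M i j ≠ 2
  symm := ⟨fun i j h => ⟨h.1.symm, by rw [M.symmetric]; exact h.2⟩⟩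
  loopless := ⟨fun _ h => h.1 rfl⟩

/-- `M` is irreducible when its Coxeter graph is connected. -/
def IsIrreducible : Prop := M.coxeterGraph.Connected

/-- `M` is of finite type when its Coxeter group is finite. -/
def IsFiniteType : Prop := Finite M.Group

/-- `M` and `N` are the same Coxeter matrix up to a renumbering of the generators. -/
def IsOfType {C : Type*} (N : CoxeterMatrix C) : Prop := ∃ e : B ≃ C, M.reindex e = N

/-- The length homomorphism `ℓ : A(M) → ℤ`, sending every standard generator to `1`. -/
def artinLength : M.ArtinGroup →* Multiplicative ℤ :=
  PresentedGroup.toGroup (f := fun _ : B => Multiplicative.ofAdd (1 : ℤ)) (by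
    rintro r ⟨i, j, -, -, rfl⟩
    simp [map_altProd])

end CoxeterMatrix

/-- For a homomorphism `f` to an abelian group (the length), the group of automorphisms `α` that
are length preserving, `f ∘ α = f`, or length reversing, `f ∘ α = -f` (written multiplicatively). -/
def autStar {G C : Type*} [Group G] [CommGroup C] (f : G →* C) : Subgroup (MulAut G) where
  carrier := {α | (∀ x, f (α x) = f x) ∨ (∀ x, f (α x) = (f x)⁻¹)}
  one_mem' := Or.inl fun _ => rfl
  mul_mem' := by
    rintro α β (hα | hα) (hβ | hβ)
    · exact Or.inl fun x => by rw [MulAut.mul_apply, hα, hβ]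
    · exact Or.inr fun x => by rw [MulAut.mul_apply, hα, hβ]
    · exact Or.inr fun x => by rw [MulAut.mul_apply, hα, hβ]
    · exact Or.inl fun x => by rw [MulAut.mul_apply, hα, hβ, inv_inv]
  inv_mem' := by
    rintro α (hα | hα)
    · exact Or.inl fun x => by simpa using (hα (α⁻¹ x)).symm
    · exact Or.inr fun x => by simpa using congrArg (·⁻¹) (hα (α⁻¹ x)).symm

theorem map_center_mulAut {G : Type*} [Group G] (α : MulAut G) :
    (Subgroup.center G).map (α : G →* G) = Subgroup.center G :=
  Subgroup.characteristic_iff_map_eq.mp inferInstance α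

/-- The natural map `Aut(G) → Aut(G/Z)`, where `Z` is the centre of `G`: the automorphism `α`
goes to `xZ ↦ α(x)Z`. -/
def autModCenter (G : Type*) [Group G] : MulAut G →* MulAut (G ⧸ Subgroup.center G) where
  toFun α := QuotientGroup.congr _ _ α (map_center_mulAut α)
  map_one' := by
    ext x
    induction x using QuotientGroup.induction_on
    rfl
  map_mul' α β := by
    ext x
    induction x using QuotientGroup.induction_on
    rfl

theorem autModCenter_mk {G : Type*} [Group G] (α : MulAut G) (x : G) :
    autModCenter G α (x : G ⧸ Subgroup.center G) = (α x : G) := rfl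

/-- `Tv(G)`: the automorphisms of `G` that are transvections `x ↦ x * lam x` for some
function `lam` from `G` to its centre. -/
def transvectionAut (G : Type*) [Group G] : Subgroup (MulAut G) where
  carrier := {α | ∃ lam : G → Subgroup.center G, ∀ x, α x = x * (lam x : G)}
  one_mem' := ⟨fun _ => 1, fun x => by simp⟩
  mul_mem' := by
    rintro α β ⟨l, hl⟩ ⟨k, hk⟩
    exact ⟨fun x => k x * l (β x), fun x => by
      rw [MulAut.mul_apply, hl (β x), Subgroup.coe_mul, ← mul_assoc, ← hk]⟩
  inv_mem' := by
    rintro α ⟨l, hl⟩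
    refine ⟨fun x => (l (α⁻¹ x))⁻¹, fun x => ?_⟩
    have h := hl (α⁻¹ x)
    rw [MulAut.apply_inv_self] at h
    rw [Subgroup.coe_inv, eq_mul_inv_iff_mul_eq]
    exact h.symm

namespace CoxeterMatrix

variable {B : Type*} (M : CoxeterMatrix B)

/-- The length homomorphism `A/Z → ℤ/dℤ` induced by `ℓ`, where `ζ` generates the centre `Z` of
`A = A(M)` and `d = ℓ(ζ)`. -/
def artinLengthModCenter (ζ : M.ArtinGroup)
    (hζ : Subgroup.zpowers ζ = Subgroup.center M.ArtinGroup) :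
    M.ArtinGroup ⧸ Subgroup.center M.ArtinGroup →*
      Multiplicative (ZMod (Multiplicative.toAdd (M.artinLength ζ)).natAbs) :=
  QuotientGroup.lift (Subgroup.center M.ArtinGroup)
    ((AddMonoidHom.toMultiplicative
      (Int.castAddHom (ZMod (Multiplicative.toAdd (M.artinLength ζ)).natAbs))).comp M.artinLength)
    (by
      intro z hz
      rw [← hζ] at hz
      obtain ⟨k, rfl⟩ := Subgroup.mem_zpowers_iff.mp hz
      rw [MonoidHom.mem_ker, map_zpow]
      have h : (AddMonoidHom.toMultiplicative
          (Int.castAddHom (ZMod (Multiplicative.toAdd (M.artinLength ζ)).natAbs))).comp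
            M.artinLength ζ = 1 := by
        apply Multiplicative.toAdd.injective
        change ((Multiplicative.toAdd (M.artinLength ζ) : ℤ) :
          ZMod (Multiplicative.toAdd (M.artinLength ζ)).natAbs) = 0
        rw [ZMod.intCast_zmod_eq_zero_iff_dvd]
        exact Int.natAbs_dvd.mpr dvd_rfl
      rw [h, one_zpow])

theorem artinLengthModCenter_mk (ζ : M.ArtinGroup)
    (hζ : Subgroup.zpowers ζ = Subgroup.center M.ArtinGroup) (x : M.ArtinGroup) :
    M.artinLengthModCenter ζ hζ (x : M.ArtinGroup ⧸ Subgroup.center M.ArtinGroup) =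
      Multiplicative.ofAdd ((Multiplicative.toAdd (M.artinLength x) : ℤ) :
        ZMod (Multiplicative.toAdd (M.artinLength ζ)).natAbs) := rfl

/-- The natural map `π : Aut*(A) → Aut*(A/Z)`, the restriction of `Aut(A) → Aut(A/Z)`. -/
def autStarMap (ζ : M.ArtinGroup) (hζ : Subgroup.zpowers ζ = Subgroup.center M.ArtinGroup) :
    autStar M.artinLength →* autStar (M.artinLengthModCenter ζ hζ) :=
  ((autModCenter M.ArtinGroup).comp (autStar M.artinLength).subtype).codRestrict _ (by
    rintro ⟨α, hα | hα⟩
    · refine Or.inl fun x => ?_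
      induction x using QuotientGroup.induction_on with
      | H x =>
        change M.artinLengthModCenter ζ hζ ((α x : M.ArtinGroup) : _ ⧸ _) = _
        rw [artinLengthModCenter_mk, artinLengthModCenter_mk, hα]
    · refine Or.inr fun x => ?_
      induction x using QuotientGroup.induction_on with
      | H x =>
        change M.artinLengthModCenter ζ hζ ((α x : M.ArtinGroup) : _ ⧸ _) = _
        rw [artinLengthModCenter_mk, artinLengthModCenter_mk, hα, toAdd_inv, Int.cast_neg,
          ofAdd_neg])

end CoxeterMatrix

/-!
The proof rests on Garside's theory of the Artin monoid `A⁺`, built here for finite type.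

*The Coxeter group.* The geometric representation shows that `s_i s_j` has order exactly `m_ij`,
that no label is `∞` when the group `W` is finite, and that the canonical bilinear form is positive
definite when `W` is moreover irreducible. The action of `W` on signed elements yields the exchange
property (`CoxeterSystem.exchange`). Hence the braid of `s_i` and `s_j` is a prefix of every `w`
that has both as left descents, every element is a prefix of the longest element `w₀`, and `w₀` is
the only element with all generators as left descents.

*The Artin monoid.* If `s_i x = s_j y` in `A⁺`, then either `i = j` and `x = y`, or both sides are
multiples of the braid of `s_i` and `s_j` (`CoxeterSystem.reducesBelow`). This is proved by
induction on the degree and on the chain of braid moves from one word to the other. The crucial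
case, three different first letters, is settled inside the finite group `W`: the simple divisors of
an element, that is, the lifts of elements of `W`, have common multiples among themselves
(`CoxeterSystem.exists_common_posLift_dvd`), and a common multiple in `W` of the two braids is a
multiple of the third. So `A⁺` is cancellative, the lift `Δ` of `w₀` is the least common multiple of
the generators and permutes them by conjugation, and `Δ²` is central. Thus `A⁺` embeds in `A`, and
every element of `A` is `Δ^(-2n) a` with `a` in `A⁺`.

*The centre.* If a generator `s_i` divides a central `a` in `A⁺` and `m_ij ≥ 3`, then
`s_j a = a s_j` is a multiple of both `s_i` and `s_j`, which forces `s_j` to divide `a`. As the graph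
is connected, `Δ` divides `a`, and by induction `a` is a power of `Δ`. Hence the centre lies in the
infinite cyclic group generated by `Δ` and contains `Δ²`; its generators have length at least
`ℓ(Δ) ≥ 3` in absolute value.

*Automorphisms.* A central element is determined by its length. If `α` is trivial modulo `Z` and
`ℓ ∘ α = ±ℓ`, then `α(s_i) = s_i z` with `ℓ(z) ∈ {0, -2}`, so that `z = 1` because `|d| ≥ 3`.
Conversely an automorphism of `A/Z` lifts: the images of the generators have unique lifts of length
exactly `±1`, and the two sides of an Artin relation between the lifts differ by a central element
of length `0`. When the abelianization is `ℤ`, every automorphism acts on it by `±1`, that is,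
`Aut(A) = Aut*(A)`.

*The exceptional types.* The abelianization is `ℤ` if all edges have odd labels. With an even label,
positive definiteness excludes the affine diagrams, which leaves `I₂(2m)`, `Bₙ` and `F₄`; in these
types the vertices fall into two classes joined by even labels only, and the abelianization has
larger rank.
-/

/-! ### Powers of a product of two reflections -/

section TwoReflections

variable {V : Type*} [AddCommGroup V] [Module ℝ V] {x y : V} {f g : Module.Dual ℝ V} {θ : ℝ}

/-- Powers of a product of two reflections at angle `θ` act on the first root as the rotation by
`2θ`. -/
theorem sin_smul_preReflection_mul_pow_apply_self (hf : f x = 2) (hg : g y = 2)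
    (hfy : f y = -2 * Real.cos θ) (hgx : g x = -2 * Real.cos θ) (k : ℕ) :
    Real.sin θ • ((Module.preReflection x f * Module.preReflection y g) ^ k) x =
      Real.sin ((2 * k + 1) * θ) • x + Real.sin (2 * k * θ) • y := by
  induction k with
  | zero => simp
  | succ k ih =>
    have e1 : Real.sin ((2 * (k + 1 : ℕ) + 1) * θ) =
        Real.sin ((2 * k + 1) * θ) * (4 * Real.cos θ ^ 2 - 1) -
          2 * Real.cos θ * Real.sin (2 * k * θ) := by
      rw [show (2 * ((k + 1 : ℕ) : ℝ) + 1) * θ = (2 * k + 1) * θ + 2 * θ by push_cast; ring,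
        show 2 * (k : ℝ) * θ = (2 * k + 1) * θ - θ by ring, Real.sin_add, Real.sin_sub,
        Real.cos_two_mul, Real.sin_two_mul]
      ring
    have e2 : Real.sin (2 * (k + 1 : ℕ) * θ) =
        2 * Real.cos θ * Real.sin ((2 * k + 1) * θ) - Real.sin (2 * k * θ) := by
      rw [show 2 * ((k + 1 : ℕ) : ℝ) * θ = (2 * k + 1) * θ + θ by push_cast; ring,
        show 2 * (k : ℝ) * θ = (2 * k + 1) * θ - θ by ring, Real.sin_add, Real.sin_sub]
      ring
    rw [pow_succ', Module.End.mul_apply, ← map_smul, ih, e1, e2]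
    simp only [Module.End.mul_apply, Module.preReflection_apply, map_add, map_sub, map_smul, hf,
      hg, hfy, hgx]
    match_scalars <;> simp <;> ring

theorem preReflection_mul_pow_apply_of_pi_div (m : ℕ) (hm : 2 ≤ m) (hθ : θ = Real.pi / m)
    (hf : f x = 2) (hg : g y = 2) (hfy : f y = -2 * Real.cos θ) (hgx : g x = -2 * Real.cos θ) :
    ((Module.preReflection x f * Module.preReflection y g) ^ m) x = x := by
  have hm0 : (m : ℝ) ≠ 0 := by positivity
  have hs : Real.sin θ ≠ 0 := by
    refine (Real.sin_pos_of_pos_of_lt_pi (by rw [hθ]; positivity) ?_).ne'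
    rw [hθ]
    exact div_lt_self Real.pi_pos (by exact_mod_cast hm)
  have h := sin_smul_preReflection_mul_pow_apply_self hf hg hfy hgx m
  have e : 2 * (m : ℝ) * θ = 2 * Real.pi := by rw [hθ]; field_simp
  rw [add_mul, e, one_mul, add_comm (2 * Real.pi), Real.sin_add_two_pi, Real.sin_two_pi,
    zero_smul, add_zero] at h
  exact smul_right_injective V hs h

/-- Two reflections at angle `π / m` generate a dihedral group in which their product has
order dividing `m`. -/
theorem preReflection_mul_pow_eq_one (m : ℕ) (hm : 2 ≤ m) (hθ : θ = Real.pi / m)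
    (hf : f x = 2) (hg : g y = 2) (hfy : f y = -2 * Real.cos θ) (hgx : g x = -2 * Real.cos θ) :
    (Module.preReflection x f * Module.preReflection y g) ^ m = 1 := by
  have hx := preReflection_mul_pow_apply_of_pi_div m hm hθ hf hg hfy hgx
  have hy' := preReflection_mul_pow_apply_of_pi_div m hm hθ hg hf hgx hfy
  set a := Module.preReflection x f with ha
  set b := Module.preReflection y g with hb
  have haa : a * a = 1 := LinearMap.ext fun z => Module.involutive_preReflection hf z
  have hbb : b * b = 1 := LinearMap.ext fun z => Module.involutive_preReflection hg z
  have hab : (a * b) * (b * a) = 1 := by rw [mul_assoc, ← mul_assoc b, hbb, one_mul, haa]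
  have hba : (b * a) * (a * b) = 1 := by rw [mul_assoc, ← mul_assoc a, haa, one_mul, hbb]
  have hcomm : Commute (a * b) (b * a) := hab.trans hba.symm
  have hy : ((a * b) ^ m) y = y := by
    conv_lhs => rw [← hy']
    rw [← Module.End.mul_apply, ← hcomm.mul_pow, hab, one_pow, Module.End.one_apply]
  have hs : 0 < Real.sin θ := by
    refine Real.sin_pos_of_pos_of_lt_pi (by rw [hθ]; positivity) ?_
    rw [hθ]
    exact div_lt_self Real.pi_pos (by exact_mod_cast hm)
  ext z
  -- `z` splits into a vector fixed by both reflections and a combination of `x` and `y`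
  set c := (f z + Real.cos θ * g z) / (2 * Real.sin θ ^ 2) with hc
  set d := (g z + Real.cos θ * f z) / (2 * Real.sin θ ^ 2) with hd
  have hsq := Real.sin_sq_add_cos_sq θ
  have hfz : f (z - c • x - d • y) = 0 := by
    simp only [map_sub, map_smul, hf, hfy, smul_eq_mul, hc, hd]
    field_simp
    linear_combination (-f z) * hsq + 2 * f z * hsq
  have hgz : g (z - c • x - d • y) = 0 := by
    simp only [map_sub, map_smul, hg, hgx, smul_eq_mul, hc, hd]
    field_simp
    linear_combination (-g z) * hsq + 2 * g z * hsq
  have hfix : ∀ k : ℕ, ((a * b) ^ k) (z - c • x - d • y) = z - c • x - d • y := by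
    intro k
    induction k with
    | zero => simp
    | succ k ih =>
      have h1 : b (z - c • x - d • y) = z - c • x - d • y := by
        rw [hb, Module.preReflection_apply, hgz, zero_smul, sub_zero]
      have h2 : a (z - c • x - d • y) = z - c • x - d • y := by
        rw [ha, Module.preReflection_apply, hfz, zero_smul, sub_zero]
      rw [pow_succ, Module.End.mul_apply, Module.End.mul_apply, h1, h2, ih]
  have := hfix m
  rw [map_sub, map_sub, map_smul, map_smul, hx, hy] at this
  rw [Module.End.one_apply]
  simpa using this

theorem preReflection_mul_pow_ne_one (m k : ℕ) (hθ : θ = Real.pi / m)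
    (hk : 0 < k) (hkm : k < m) (hxy : LinearIndependent ℝ ![x, y])
    (hf : f x = 2) (hg : g y = 2) (hfy : f y = -2 * Real.cos θ) (hgx : g x = -2 * Real.cos θ) :
    (Module.preReflection x f * Module.preReflection y g) ^ k ≠ 1 := by
  intro h
  have hm0 : (0 : ℝ) < m := by exact_mod_cast hk.trans hkm
  have hs : 0 < Real.sin θ := by
    refine Real.sin_pos_of_pos_of_lt_pi (by rw [hθ]; positivity) ?_
    rw [hθ]
    exact div_lt_self Real.pi_pos (by exact_mod_cast (by omega : 1 < m))
  have e := sin_smul_preReflection_mul_pow_apply_self hf hg hfy hgx k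
  rw [h, Module.End.one_apply] at e
  have := LinearIndependent.pair_iff.mp hxy (Real.sin ((2 * k + 1) * θ) - Real.sin θ)
    (Real.sin (2 * k * θ)) (by rw [sub_smul, e]; abel)
  obtain ⟨h1, h2⟩ := this
  rw [add_mul, one_mul, Real.sin_add, h2] at h1
  have h3 : Real.cos (2 * k * θ) = 1 := by
    have : (Real.cos (2 * k * θ) - 1) * Real.sin θ = 0 := by linear_combination h1
    rcases mul_eq_zero.mp this with h | h
    · linarith
    · exact absurd h hs.ne'
  have h4 : 0 < 2 * k * θ := by rw [hθ]; positivity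
  have h5 : 2 * k * θ < 2 * Real.pi := by
    rw [hθ, mul_assoc, mul_div_left_comm]
    have : (k : ℝ) / m < 1 := by rw [div_lt_one hm0]; exact_mod_cast hkm
    nlinarith [Real.pi_pos, mul_div_left_comm (k : ℝ) Real.pi m]
  rw [Real.cos_eq_one_iff_of_lt_of_lt (by linarith [Real.pi_pos]) h5] at h3
  exact h4.ne' h3

/-- Two reflections with `⟨x, y⟩ = -1` have a product of infinite order. -/
theorem preReflection_mul_pow_ne_one_of_neg_two (k : ℕ) (hk : 0 < k)
    (hxy : LinearIndependent ℝ ![x, y])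
    (hf : f x = 2) (hg : g y = 2) (hfy : f y = -2) (hgx : g x = -2) :
    (Module.preReflection x f * Module.preReflection y g) ^ k ≠ 1 := by
  intro h
  have e : ∀ k : ℕ, ((Module.preReflection x f * Module.preReflection y g) ^ k) x =
      (2 * k + 1 : ℝ) • x + (2 * k : ℝ) • y := by
    intro k
    induction k with
    | zero => simp
    | succ k ih =>
      rw [pow_succ', Module.End.mul_apply, ih]
      simp only [Module.End.mul_apply, Module.preReflection_apply, map_add, map_sub, map_smul, hf,
        hg, hfy, hgx]
      match_scalars <;> ring
  have e := e k
  rw [h, Module.End.one_apply] at e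
  have := LinearIndependent.pair_iff.mp hxy (2 * k) (2 * k) (by
    have e' := congrArg (fun v => v - x) e
    simp only [sub_self] at e'
    rw [e']
    module)
  have h1 : (k : ℝ) = 0 := by linarith [this.1]
  exact hk.ne' (by exact_mod_cast h1)

end TwoReflections

/-! ### The geometric representation -/

namespace CoxeterMatrix

variable {B : Type*} (M : CoxeterMatrix B)

/-- The entry `-cos (π / m_ij)` of the Gram matrix of the simple roots. When `m_ij = ∞`, encoded
by `0`, the convention `π / 0 = 0` gives the customary value `-1`. -/
noncomputable def gram (i j : B) : ℝ := -Real.cos (Real.pi / M i j)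

theorem gram_self (i : B) : M.gram i i = 1 := by simp [gram]

theorem gram_comm (i j : B) : M.gram i j = M.gram j i := by rw [gram, gram, M.symmetric]

theorem two_le_of_ne {i j : B} (h : i ≠ j) (h0 : M i j ≠ 0) : 2 ≤ M i j := by
  have := M.off_diagonal i j h
  omega

section

variable [Fintype B]

/-- The linear functional `v ↦ ⟨e_i, v⟩` of the canonical bilinear form. -/
noncomputable def gramDual (i : B) : Module.Dual ℝ (B → ℝ) :=
  ∑ j, M.gram i j • LinearMap.proj j

theorem gramDual_apply (i : B) (v : B → ℝ) : M.gramDual i v = ∑ j, M.gram i j * v j := by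
  simp [gramDual]

variable [DecidableEq B]

theorem gramDual_single (i j : B) : M.gramDual i (Pi.single j 1) = M.gram i j := by
  simp [gramDual_apply, Pi.single_apply]

/-- The reflection `v ↦ v - 2 ⟨e_i, v⟩ e_i` of the geometric representation. -/
noncomputable def geomReflection (i : B) : Module.End ℝ (B → ℝ) :=
  Module.preReflection (Pi.single i 1) ((2 : ℝ) • M.gramDual i)

theorem isLiftable_geomReflection : M.IsLiftable M.geomReflection := by
  intro i j
  by_cases hij : i = j
  · subst hij
    rw [M.diagonal, pow_one]
    exact LinearMap.ext fun z => Module.involutive_preReflection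
      (by simp [gramDual_single, gram_self]) z
  · by_cases h0 : M i j = 0
    · rw [h0, pow_zero]
    · refine preReflection_mul_pow_eq_one (M i j) (M.two_le_of_ne hij h0) rfl ?_ ?_ ?_ ?_
      · simp [gramDual_single, gram_self]
      · simp [gramDual_single, gram_self]
      · simp [gramDual_single, gram]
      · simp [gramDual_single, gram, M.symmetric j i]

end

theorem linearIndependent_single_pair [DecidableEq B] {i j : B} (h : i ≠ j) :
    LinearIndependent ℝ ![(Pi.single i 1 : B → ℝ), Pi.single j 1] := by
  rw [LinearIndependent.pair_iff]
  intro s t hst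
  have h1 := congrFun hst i
  have h2 := congrFun hst j
  simp [h, h.symm] at h1 h2
  exact ⟨h1, h2⟩

end CoxeterMatrix

namespace CoxeterSystem

variable {B W : Type*} [Group W] {M : CoxeterMatrix B} (cs : CoxeterSystem M W)

/-- The geometric representation of a Coxeter group on `B → ℝ`. -/
noncomputable def geomRep [Fintype B] [DecidableEq B] : W →* Module.End ℝ (B → ℝ) :=
  cs.lift ⟨M.geomReflection, M.isLiftable_geomReflection⟩

theorem geomRep_simple [Fintype B] [DecidableEq B] (i : B) :
    cs.geomRep (cs.simple i) = M.geomReflection i :=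
  cs.lift_apply_simple _ i

theorem simple_mul_simple_pow_ne_one [Finite B] {i j : B} (hij : i ≠ j) {k : ℕ} (hk : 0 < k)
    (hkm : M i j = 0 ∨ k < M i j) : (cs.simple i * cs.simple j) ^ k ≠ 1 := by
  classical
  have := Fintype.ofFinite B
  intro h
  have h' := congrArg cs.geomRep h
  rw [map_pow, map_mul, geomRep_simple, geomRep_simple, map_one] at h'
  rcases hkm with h0 | hkm
  · refine preReflection_mul_pow_ne_one_of_neg_two k hk
      (CoxeterMatrix.linearIndependent_single_pair hij) ?_ ?_ ?_ ?_ h'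
    · simp [M.gramDual_single, M.gram_self]
    · simp [M.gramDual_single, M.gram_self]
    · simp [M.gramDual_single, CoxeterMatrix.gram, h0]
    · simp [M.gramDual_single, CoxeterMatrix.gram, M.symmetric j i, h0]
  · refine preReflection_mul_pow_ne_one (M i j) k rfl hk hkm
      (CoxeterMatrix.linearIndependent_single_pair hij) ?_ ?_ ?_ ?_ h'
    · simp [M.gramDual_single, M.gram_self]
    · simp [M.gramDual_single, M.gram_self]
    · simp [M.gramDual_single, CoxeterMatrix.gram]
    · simp [M.gramDual_single, CoxeterMatrix.gram, M.symmetric j i]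

/-- A finite Coxeter group has no label `∞`. -/
theorem matrix_ne_zero [Finite B] [Finite W] (cs : CoxeterSystem M W) (i j : B) :
    M i j ≠ 0 := by
  intro h0
  by_cases hij : i = j
  · subst hij
    simp at h0
  · obtain ⟨k, hk, h⟩ := (isOfFinOrder_of_finite (cs.simple i * cs.simple j)).exists_pow_eq_one
    exact cs.simple_mul_simple_pow_ne_one hij hk (Or.inl h0) h

/-- The canonical form of a finite irreducible Coxeter group is positive definite. Every `s i` is an
orthogonal reflection for the inner product averaged over `W`, so that this inner product is
proportional to the canonical form on each connected component; `hconn` states connectedness. -/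
theorem exists_gram_pos [Fintype B] [DecidableEq B] [Finite W] (cs : CoxeterSystem M W)
    (hconn : ∀ c : B → ℝ, (∀ i j, M.gram i j ≠ 0 → c i = c j) → ∀ i j, c i = c j)
    {v : B → ℝ} (hv : v ≠ 0) : 0 < ∑ i, ∑ j, v i * v j * M.gram i j := by
  have := Fintype.ofFinite W
  -- the invariant inner product obtained by averaging over `W`
  let Q : (B → ℝ) →ₗ[ℝ] (B → ℝ) →ₗ[ℝ] ℝ := LinearMap.mk₂ ℝ
    (fun v w => ∑ g : W, ∑ b, cs.geomRep g v b * cs.geomRep g w b)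
    (by intros; simp [add_mul, Finset.sum_add_distrib])
    (by intros; simp [mul_assoc, Finset.mul_sum])
    (by intros; simp [mul_add, Finset.sum_add_distrib])
    (by intros; simp [mul_left_comm, Finset.mul_sum])
  have hQ : ∀ v w, Q v w = ∑ g : W, ∑ b, cs.geomRep g v b * cs.geomRep g w b := fun v w => rfl
  have hinv : ∀ (h : W) v w, Q (cs.geomRep h v) (cs.geomRep h w) = Q v w := by
    intro h v w
    rw [hQ, hQ]
    refine Fintype.sum_equiv (Equiv.mulRight h) _ _ fun g => ?_
    simp [map_mul]
  have hsymm : ∀ v w, Q v w = Q w v := fun v w => by simp only [hQ, mul_comm]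
  have hpos : ∀ v, v ≠ 0 → 0 < Q v v := by
    intro v hv
    obtain ⟨b, hb⟩ := Function.ne_iff.mp hv
    rw [hQ]
    refine Finset.sum_pos' (fun g _ => Finset.sum_nonneg fun b _ => mul_self_nonneg _)
      ⟨1, Finset.mem_univ _, Finset.sum_pos' (fun b _ => mul_self_nonneg _)
        ⟨b, Finset.mem_univ _, ?_⟩⟩
    rw [map_one, Module.End.one_apply]
    exact mul_self_pos.mpr hb
  have key : ∀ v i, Q v (Pi.single i 1) = M.gramDual i v * Q (Pi.single i 1) (Pi.single i 1) := by
    intro v i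
    have h := hinv (cs.simple i) v (Pi.single i 1)
    rw [geomRep_simple, CoxeterMatrix.geomReflection, Module.preReflection_apply_self
      (by simp [M.gramDual_single, M.gram_self]), Module.preReflection_apply] at h
    simp only [map_neg, map_sub, map_smul, LinearMap.sub_apply, LinearMap.smul_apply,
      smul_eq_mul] at h
    linarith
  have hc : ∀ i j, Q (Pi.single i 1) (Pi.single i 1) = Q (Pi.single j 1) (Pi.single j 1) := by
    refine hconn _ fun i j hij => ?_
    have h1 := key (Pi.single j 1) i
    have h2 := key (Pi.single i 1) j
    rw [hsymm, h2, M.gramDual_single, M.gramDual_single, M.gram_comm j i] at h1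
    exact (mul_left_cancel₀ hij h1).symm
  obtain ⟨b, hb⟩ := Function.ne_iff.mp hv
  have hcb : 0 < Q (Pi.single b 1) (Pi.single b 1) := hpos _ (by simp)
  have hvv : Q v v = (∑ i, ∑ j, v i * v j * M.gram i j) * Q (Pi.single b 1) (Pi.single b 1) := by
    have hsum : v = ∑ i, v i • (Pi.single i 1 : B → ℝ) := by
      ext j
      simp [Pi.single_apply]
    conv_lhs => enter [2]; rw [hsum]
    rw [map_sum, Finset.sum_mul]
    refine Finset.sum_congr rfl fun i _ => ?_
    rw [map_smul, key, hc i b, M.gramDual_apply, smul_eq_mul, ← mul_assoc, Finset.mul_sum]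
    congr 1
    exact Finset.sum_congr rfl fun j _ => by ring
  exact pos_of_mul_pos_left (hvv ▸ hpos v hv) hcb.le

end CoxeterSystem

/-! ### The exchange property and the weak order -/

namespace CoxeterSystem

variable {B W : Type*} [Group W] {M : CoxeterMatrix B} (cs : CoxeterSystem M W)

local prefix:100 "s" => cs.simple
local prefix:100 "ℓ" => cs.length

section Reflection

open Classical in
/-- The action of the simple reflection `s i` on signed elements: conjugation by `s i` on the
first component, with a change of sign exactly at `s i` itself. Only the reflections among the
elements of `W` matter, but acting on all of `W` avoids a subtype. -/
noncomputable def signPerm (i : B) : Function.End (W × ZMod 2) := fun p =>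
  (s i * p.1 * s i, p.2 + if p.1 = s i then 1 else 0)

theorem signPerm_mul_pow_apply (i j : B) (k : ℕ) (t : W) (e : ZMod 2) :
    open Classical in
    ((cs.signPerm i * cs.signPerm j) ^ k) (t, e) =
      ((s i * s j) ^ k * t * ((s i * s j) ^ k)⁻¹,
        e + ∑ l ∈ Finset.range (2 * k), if t = s j * (s i * s j) ^ l then 1 else 0) := by
  classical
  induction k with
  | zero => exact Prod.ext (by simp; rfl) (by simp; rfl)
  | succ k ih =>
    have hpow : ∀ l : ℕ, ((s i * s j) ^ l)⁻¹ * s j = s j * (s i * s j) ^ l := by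
      intro l
      rw [← inv_pow, mul_inv_rev, inv_simple, inv_simple]
      induction l with
      | zero => simp
      | succ l ih =>
        rw [pow_succ', mul_assoc, ih, pow_succ' _ l]
        simp only [mul_assoc]
    have h1 : ∀ t : W, (s i * s j) ^ k * t * ((s i * s j) ^ k)⁻¹ = s j ↔
        t = s j * (s i * s j) ^ (2 * k) := by
      intro t
      rw [mul_inv_eq_iff_eq_mul, ← eq_inv_mul_iff_mul_eq, ← mul_assoc, hpow, mul_assoc, ← pow_add,
        two_mul]
    have h2 : ∀ t : W, s j * ((s i * s j) ^ k * t * ((s i * s j) ^ k)⁻¹) * s j = s i ↔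
        t = s j * (s i * s j) ^ (2 * k + 1) := by
      intro t
      rw [← eq_mul_inv_iff_mul_eq, inv_simple, ← eq_inv_mul_iff_mul_eq, inv_simple,
        mul_inv_eq_iff_eq_mul, ← eq_inv_mul_iff_mul_eq, ← mul_assoc, ← mul_assoc, hpow, mul_assoc,
        mul_assoc, ← pow_succ', ← pow_add, ← add_assoc, two_mul]
    have e1 : ((cs.signPerm i * cs.signPerm j) ^ (k + 1)) (t, e) =
        cs.signPerm i (cs.signPerm j (((cs.signPerm i * cs.signPerm j) ^ k) (t, e))) := by
      rw [pow_succ']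
      rfl
    rw [e1, ih]
    simp only [signPerm, h1, h2]
    refine Prod.ext ?_ ?_
    · simp only [pow_succ' _ k, mul_inv_rev, inv_simple, mul_assoc]
    · rw [show 2 * (k + 1) = 2 * k + 1 + 1 by ring, Finset.sum_range_succ, Finset.sum_range_succ]
      simp only [add_assoc]

/-- The braid relations hold because `u ^ l`, where `u = s i * s j`, runs twice through the same
values for `l < 2 * M i j`, so that the signs cancel in pairs. -/
theorem isLiftable_signPerm : M.IsLiftable cs.signPerm := by
  classical
  intro i j
  funext ⟨t, e⟩
  rw [signPerm_mul_pow_apply, simple_mul_simple_pow, two_mul, Finset.sum_range_add]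
  have : ∀ l, (s i * s j) ^ (M i j + l) = (s i * s j) ^ l := fun l => by
    rw [pow_add, simple_mul_simple_pow, one_mul]
  simp only [this, CharTwo.add_self_eq_zero, add_zero, one_mul, inv_one, mul_one]
  rfl

/-- The action of `W` on signed elements that extends `signPerm`. -/
noncomputable def signAction : W →* Function.End (W × ZMod 2) :=
  cs.lift ⟨cs.signPerm, cs.isLiftable_signPerm⟩

/-- The sign change of `t` under `w`. For a reflection `t` it is `1` exactly when `t` is a right
inversion of `w`, see `inversionParity_eq_one_iff`. -/
noncomputable def inversionParity (w t : W) : ZMod 2 := (cs.signAction w (t, 0)).2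

theorem signAction_apply (w t : W) (e : ZMod 2) :
    cs.signAction w (t, e) = (w * t * w⁻¹, e + cs.inversionParity w t) := by
  classical
  induction w using cs.simple_induction_left generalizing t e with
  | one =>
    rw [inversionParity, map_one]
    exact Prod.ext (by simp; rfl) (by change e = e + 0; simp)
  | mul_simple_left w i ih =>
    have h : ∀ e, cs.signAction (s i * w) (t, e) =
        (s i * w * t * (s i * w)⁻¹,
          e + (cs.inversionParity w t + if w * t * w⁻¹ = s i then 1 else 0)) := by
      intro e
      rw [map_mul, show (cs.signAction (s i) * cs.signAction w) (t, e) =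
        cs.signAction (s i) (cs.signAction w (t, e)) from rfl, ih, signAction, lift_apply_simple]
      simp [signPerm, mul_assoc, add_assoc]
    rw [h, inversionParity.eq_1 _ (s i * w), h, zero_add]

theorem inversionParity_mul (v w t : W) :
    cs.inversionParity (v * w) t =
      cs.inversionParity w t + cs.inversionParity v (w * t * w⁻¹) := by
  have : cs.signAction (v * w) (t, 0) = cs.signAction v (cs.signAction w (t, 0)) := by
    rw [map_mul]; rfl
  rw [inversionParity, this, signAction_apply, signAction_apply, zero_add]

theorem inversionParity_one (t : W) : cs.inversionParity 1 t = 0 := by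
  rw [inversionParity, map_one]
  rfl

theorem inversionParity_simple (i : B) (t : W) :
    open Classical in cs.inversionParity (s i) t = if t = s i then 1 else 0 := by
  classical
  rw [inversionParity, signAction, lift_apply_simple]
  simp [signPerm]

theorem inversionParity_self {t : W} (ht : cs.IsReflection t) : cs.inversionParity t t = 1 := by
  obtain ⟨v, i, rfl⟩ := ht
  have h := cs.inversionParity_mul v v⁻¹ (v * s i * v⁻¹)
  rw [mul_inv_cancel, inversionParity_one] at h
  rw [inversionParity_mul, inversionParity_mul]
  simp only [mul_assoc, inv_inv, inv_mul_cancel_left, inv_mul_cancel, mul_one, inv_simple,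
    inversionParity_simple, simple_mul_simple_cancel_left, if_true] at h ⊢
  linear_combination -h

theorem mem_rightInvSeq_of_inversionParity (ω : List B) (t : W)
    (h : cs.inversionParity (cs.wordProd ω) t = 1) : t ∈ cs.rightInvSeq ω := by
  classical
  induction ω with
  | nil => simp [inversionParity_one] at h
  | cons i ω ih =>
    rw [wordProd_cons, inversionParity_mul, inversionParity_simple] at h
    rw [rightInvSeq, List.mem_cons]
    by_cases h1 : cs.wordProd ω * t * (cs.wordProd ω)⁻¹ = s i
    · left
      rw [← h1]
      group
    · right
      rw [if_neg h1, add_zero] at h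
      exact ih h

/-- A reflection shortens `w` exactly when its inversion parity is odd. -/
theorem inversionParity_eq_one_iff {t : W} (ht : cs.IsReflection t) (w : W) :
    cs.inversionParity w t = 1 ↔ ℓ (w * t) < ℓ w := by
  have key : ∀ w, cs.inversionParity w t = 1 → ℓ (w * t) < ℓ w := by
    intro w hw
    obtain ⟨ω, hω, rfl⟩ := cs.exists_isReduced w
    exact (cs.isRightInversion_of_mem_rightInvSeq hω
      (cs.mem_rightInvSeq_of_inversionParity ω t hw)).2
  refine ⟨key w, fun h => ?_⟩
  by_contra h1
  have h0 : cs.inversionParity w t = 0 := by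
    generalize cs.inversionParity w t = x at h1
    revert h1
    revert x
    decide
  have := key (w * t) (by
    rw [inversionParity_mul, inversionParity_self cs ht, mul_inv_cancel_right, h0, add_zero])
  rw [mul_assoc, ht.mul_self, mul_one] at this
  omega

/-- The exchange property: a reflection that shortens `a * x` on the left
shortens `a`, or is absorbed by `x`. -/
theorem exchange {t : W} (ht : cs.IsReflection t) (a x : W) (h : ℓ (t * (a * x)) < ℓ (a * x)) :
    ℓ (t * a) < ℓ a ∨ ℓ (a⁻¹ * t * a * x) < ℓ x := by
  have hconj : cs.IsReflection (a⁻¹ * t * a) := by simpa using ht.conj a⁻¹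
  have flip : ∀ {u : W} (_ : cs.IsReflection u) (w : W), ℓ (u * w) < ℓ w ↔
      cs.inversionParity w⁻¹ u = 1 := by
    intro u hu w
    rw [cs.inversionParity_eq_one_iff hu, ← cs.length_inv w, ← cs.length_inv (u * w), mul_inv_rev,
      hu.inv]
  rw [flip ht, mul_inv_rev, inversionParity_mul, inv_inv] at h
  rw [flip ht, flip hconj]
  generalize cs.inversionParity a⁻¹ t = p at *
  generalize cs.inversionParity x⁻¹ (a⁻¹ * t * a) = q at *
  revert p q
  decide

end Reflection

/-! ### The weak order -/

section WeakOrder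

/-- The weak order on a Coxeter group: `a` is a prefix of a reduced word of `w`. -/
def IsPrefix (a w : W) : Prop := ℓ a + ℓ (a⁻¹ * w) = ℓ w

variable {cs}

theorem IsPrefix.length_mul {a w : W} (h : cs.IsPrefix a w) : ℓ a + ℓ (a⁻¹ * w) = ℓ w := h

theorem isPrefix_refl (a : W) : cs.IsPrefix a a := by simp [IsPrefix]

theorem one_isPrefix (a : W) : cs.IsPrefix 1 a := by simp [IsPrefix]

theorem isPrefix_mul_iff {a x : W} : cs.IsPrefix a (a * x) ↔ ℓ (a * x) = ℓ a + ℓ x := by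
  rw [IsPrefix, inv_mul_cancel_left, eq_comm]

theorem isPrefix_of_le {a w : W} (h : ℓ a + ℓ (a⁻¹ * w) ≤ ℓ w) : cs.IsPrefix a w := by
  refine le_antisymm h ?_
  simpa using cs.length_mul_le a (a⁻¹ * w)

theorem IsPrefix.trans {a b c : W} (hab : cs.IsPrefix a b) (hbc : cs.IsPrefix b c) :
    cs.IsPrefix a c := by
  refine isPrefix_of_le ?_
  have h1 := cs.length_mul_le (a⁻¹ * b) (b⁻¹ * c)
  rw [show a⁻¹ * b * (b⁻¹ * c) = a⁻¹ * c by group] at h1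
  have := hab.length_mul
  have := hbc.length_mul
  omega

theorem IsPrefix.mul_left {a x y : W} (h : cs.IsPrefix x y) (hy : cs.IsPrefix a (a * y)) :
    cs.IsPrefix (a * x) (a * y) := by
  rw [isPrefix_mul_iff] at hy
  refine isPrefix_of_le ?_
  rw [show (a * x)⁻¹ * (a * y) = x⁻¹ * y by group, hy]
  have := h.length_mul
  have := cs.length_mul_le a x
  omega

theorem IsPrefix.mul_left_of_prefix {a x y : W} (h : cs.IsPrefix x y)
    (hy : cs.IsPrefix a (a * y)) : cs.IsPrefix a (a * x) := by
  have h1 := (h.mul_left hy).length_mul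
  rw [show (a * x)⁻¹ * (a * y) = x⁻¹ * y by group, isPrefix_mul_iff.mp hy] at h1
  rw [isPrefix_mul_iff]
  have := h.length_mul
  omega

theorem IsPrefix.of_mul_left {a x y : W} (h : cs.IsPrefix (a * x) (a * y))
    (hx : cs.IsPrefix a (a * x)) : cs.IsPrefix x y := by
  have h1 := h.length_mul
  rw [show (a * x)⁻¹ * (a * y) = x⁻¹ * y by group, isPrefix_mul_iff.mp hx] at h1
  refine isPrefix_of_le ?_
  have := cs.length_mul_le a y
  omega

theorem simple_isPrefix_iff {i : B} {w : W} : cs.IsPrefix (s i) w ↔ cs.IsLeftDescent w i := by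
  rw [IsPrefix, isLeftDescent_iff, inv_simple, length_simple, add_comm]

theorem exists_simple_isPrefix {w : W} (hw : w ≠ 1) : ∃ i, cs.IsPrefix (s i) w := by
  obtain ⟨i, hi⟩ := cs.exists_leftDescent_of_ne_one hw
  exact ⟨i, simple_isPrefix_iff.mpr hi⟩

end WeakOrder

/-! ### Rank two parabolic subgroups -/

section Dihedral

/-- The left inversions of an alternating product lie among its dihedral reflections. -/
theorem exists_pow_of_length_mul_altProd_lt {t : W} (ht : cs.IsReflection t) (i j : B) (k : ℕ)
    (h : ℓ (t * altProd (s i) (s j) k) < ℓ (altProd (s i) (s j) k)) :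
    ∃ p < k, t = (s i * s j) ^ p * s i := by
  induction k generalizing i j t with
  | zero => simp [altProd] at h
  | succ k ih =>
    rcases cs.exchange ht _ _ h with h1 | h1
    · refine ⟨0, by omega, ?_⟩
      rw [length_simple, Nat.lt_one_iff, length_eq_zero_iff] at h1
      rw [eq_inv_of_mul_eq_one_left h1]
      simp
    · rw [inv_simple] at h1
      obtain ⟨p, hp, e⟩ := ih (by simpa using ht.conj (s i)) j i h1
      refine ⟨p + 1, by omega, ?_⟩
      have : t = s i * ((s j * s i) ^ p * s j) * s i := by
        rw [← e]
        simp [mul_assoc]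
      rw [this, pow_succ', mul_pow_mul]
      simp only [mul_assoc, mul_pow_mul]

/-- Alternating words of length at most `M i j` are reduced, because `s i * s j` has order
exactly `M i j`. -/
theorem length_altProd [Finite B] {i j : B} (hij : i ≠ j) {k : ℕ}
    (hk : M i j = 0 ∨ k ≤ M i j) : ℓ (altProd (s i) (s j) k) = k := by
  induction k generalizing i j with
  | zero => simp [altProd]
  | succ k ih =>
    have hk' : M j i = 0 ∨ k ≤ M j i := by rw [M.symmetric]; omega
    have h := ih hij.symm hk'
    rw [altProd]
    rcases cs.length_simple_mul (altProd (s j) (s i) k) i with h1 | h1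
    · omega
    · exfalso
      obtain ⟨p, hp, e⟩ := cs.exists_pow_of_length_mul_altProd_lt (cs.isReflection_simple i) j i k
        (by omega)
      refine cs.simple_mul_simple_pow_ne_one hij.symm (k := p + 1) (by omega)
        (by rw [M.symmetric]; omega) ?_
      rw [pow_succ, ← mul_assoc, ← e, simple_mul_simple_self]

theorem altProd_simple_comm (i j : B) :
    altProd (s i) (s j) (M i j) = altProd (s j) (s i) (M i j) := by
  have h : ∀ (k : ℕ) (i j : B),
      altProd (s j) (s i) k = (cs.wordProd (alternatingWord i j k))⁻¹ := by
    intro k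
    induction k with
    | zero => simp [altProd, alternatingWord]
    | succ k ih =>
      intro i j
      rw [altProd, ih, alternatingWord_succ, wordProd_concat, mul_inv_rev, inv_simple]
  rw [h, h, M.symmetric i j, cs.wordProd_braidWord_eq j i, M.symmetric j i]

variable {cs} in
/-- The longest element of a rank two parabolic subgroup is a prefix of every
element having both its generators as left descents. -/
theorem altProd_isPrefix [Finite B] {i j : B} (hij : i ≠ j) {w : W}
    (hi : cs.IsPrefix (s i) w) (hj : cs.IsPrefix (s j) w) {k : ℕ} (hk : M i j = 0 ∨ k ≤ M i j) :
    cs.IsPrefix (altProd (s i) (s j) k) w := by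
  induction k generalizing i j with
  | zero => exact one_isPrefix w
  | succ k ih =>
    have hk' : M j i = 0 ∨ k ≤ M j i := by rw [M.symmetric]; omega
    have h := ih hij.symm hj hi hk'
    have l1 := cs.length_altProd hij hk
    have l2 := cs.length_altProd hij.symm hk'
    have hp := h.length_mul
    rw [altProd] at l1 ⊢
    set a := altProd (s j) (s i) k with ha
    have h1 := cs.exchange (cs.isReflection_simple i) a (a⁻¹ * w)
      (by rw [mul_inv_cancel_left]; exact simple_isPrefix_iff.mp hi)
    refine isPrefix_of_le ?_
    rcases h1 with h1 | h1
    · omega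
    · rw [show a⁻¹ * s i * a * (a⁻¹ * w) = (s i * a)⁻¹ * w by
        rw [mul_inv_rev, inv_simple]; group] at h1
      omega

end Dihedral

/-! ### The longest element -/

section Longest

variable [Finite W]

theorem exists_longest : ∃ w₀ : W, ∀ w, ℓ w ≤ ℓ w₀ := Finite.exists_max cs.length

/-- An element of maximal length of a finite Coxeter group. -/
noncomputable def longest : W := cs.exists_longest.choose

theorem length_le_longest (w : W) : ℓ w ≤ ℓ cs.longest := cs.exists_longest.choose_spec w

/-- Every reflection shortens the longest element, so that
every element of the group is one of its prefixes. -/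
theorem isPrefix_longest (w : W) : cs.IsPrefix w cs.longest := by
  induction h : ℓ w generalizing w with
  | zero =>
    rw [length_eq_zero_iff] at h
    rw [h]
    exact one_isPrefix _
  | succ n ih =>
    obtain ⟨i, hi⟩ := cs.exists_rightDescent_of_ne_one (w := w) (by rintro rfl; simp at h)
    rw [isRightDescent_iff] at hi
    have hp := ih (w * s i) (by omega)
    set y := w * s i with hy
    have hw : w = y * s i := by simp [hy]
    have ht : cs.IsReflection (y * s i * y⁻¹) := (cs.isReflection_simple i).conj y
    have hlt : ℓ (y * s i * y⁻¹ * cs.longest) < ℓ cs.longest :=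
      lt_of_le_of_ne (cs.length_le_longest _) (ht.length_mul_right_ne _)
    rcases cs.exchange ht y (y⁻¹ * cs.longest) (by rwa [mul_inv_cancel_left]) with h1 | h1
    · rw [inv_mul_cancel_right, ← hw] at h1
      omega
    · have e : y⁻¹ * (y * s i * y⁻¹) * y * (y⁻¹ * cs.longest) = w⁻¹ * cs.longest := by
        rw [show w⁻¹ = s i * y⁻¹ by rw [hw, mul_inv_rev, inv_simple]]
        group
      rw [e] at h1
      have := hp.length_mul
      exact isPrefix_of_le (by omega)

theorem length_mul_longest (w : W) : ℓ (w * cs.longest) + ℓ w = ℓ cs.longest := by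
  have := (cs.isPrefix_longest w⁻¹).length_mul
  rw [inv_inv, length_inv] at this
  omega

theorem longest_mul_self : cs.longest * cs.longest = 1 := by
  have := cs.length_mul_longest cs.longest
  exact cs.length_eq_zero_iff.mp (by omega)

theorem longest_inv : cs.longest⁻¹ = cs.longest := inv_eq_of_mul_eq_one_left cs.longest_mul_self

theorem length_longest_mul (w : W) : ℓ (cs.longest * w) + ℓ w = ℓ cs.longest := by
  have := cs.length_mul_longest w⁻¹
  rwa [← cs.length_inv (w⁻¹ * _), mul_inv_rev, inv_inv, longest_inv, length_inv] at this

theorem exists_longest_conj_simple (i : B) : ∃ j, s i * cs.longest = cs.longest * s j := by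
  have h1 := cs.length_mul_longest (s i)
  have h2 := cs.length_longest_mul (s i * cs.longest)
  rw [length_simple] at h1
  obtain ⟨j, hj⟩ := cs.length_eq_one_iff.mp
    (show ℓ (cs.longest * (s i * cs.longest)) = 1 by omega)
  refine ⟨j, ?_⟩
  rw [← hj, ← mul_assoc, ← mul_assoc, longest_mul_self, one_mul]

variable {cs} in
/-- The longest element is the only one with every simple reflection as a left descent. -/
theorem eq_longest_of_forall_isPrefix {w : W} (h : ∀ i, cs.IsPrefix (s i) w) :
    w = cs.longest := by
  suffices cs.longest * w = 1 by
    rw [← cs.longest_inv]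
    exact eq_inv_of_mul_eq_one_right this
  by_contra hne
  obtain ⟨i, hi⟩ := cs.exists_leftDescent_of_ne_one hne
  obtain ⟨j, hj⟩ := cs.exists_longest_conj_simple i
  rw [isLeftDescent_iff, ← mul_assoc, hj, mul_assoc] at hi
  have h1 := cs.length_longest_mul (s j * w)
  have h2 := cs.length_longest_mul w
  have h3 := (cs.isLeftDescent_iff).mp (simple_isPrefix_iff.mp (h j))
  omega

end Longest

end CoxeterSystem

/-! ### Words, the Artin monoid and Matsumoto's theorem -/

/-- The alternating word `i, j, i, …` of length `m` that starts with `i`. Mathlib's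
`CoxeterSystem.alternatingWord` fixes the last letter instead of the first. -/
def altWord {B : Type*} : B → B → ℕ → List B
  | _, _, 0 => []
  | i, j, m + 1 => i :: altWord j i m

theorem length_altWord {B : Type*} (i j : B) (m : ℕ) : (altWord i j m).length = m := by
  induction m generalizing i j with
  | zero => rfl
  | succ m ih => rw [altWord, List.length_cons, ih]

theorem prod_map_altWord {B G : Type*} [Monoid G] (f : B → G) (i j : B) (m : ℕ) :
    ((altWord i j m).map f).prod = altProd (f i) (f j) m := by
  induction m generalizing i j with
  | zero => rfl
  | succ m ih => rw [altWord, List.map_cons, List.prod_cons, ih, altProd]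

theorem mul_altProd_pred {G : Type*} [Monoid G] (a b : G) {m : ℕ} (hm : m ≠ 0) :
    a * altProd b a (m - 1) = altProd a b m := by
  obtain ⟨m, rfl⟩ := Nat.exists_eq_succ_of_ne_zero hm
  rfl

namespace CoxeterMatrix

variable {B : Type*} (M : CoxeterMatrix B)

/-- One application of a braid relation inside a word. For `M i j = 0` both alternating words are
empty, so that no relation is imposed. -/
inductive BraidStep : List B → List B → Prop
  | intro (p q : List B) (i j : B) (hij : i ≠ j) :
    BraidStep (p ++ (altWord i j (M i j) ++ q)) (p ++ (altWord j i (M i j) ++ q))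

theorem BraidStep.symm {x y : List B} (h : M.BraidStep x y) : M.BraidStep y x := by
  obtain ⟨p, q, i, j, hij⟩ := h
  rw [M.symmetric i j]
  exact ⟨p, q, j, i, hij.symm⟩

theorem BraidStep.append {x y : List B} (h : M.BraidStep x y) (u v : List B) :
    M.BraidStep (u ++ x ++ v) (u ++ y ++ v) := by
  obtain ⟨p, q, i, j, hij⟩ := h
  have := BraidStep.intro (M := M) (u ++ p) (q ++ v) i j hij
  simpa only [List.append_assoc] using this

/-- Two words are congruent when a chain of braid moves joins them. -/
def braidCon : Con (FreeMonoid B) where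
  r x y := Relation.ReflTransGen M.BraidStep x.toList y.toList
  iseqv := ⟨fun _ => .refl, fun h => by
      have : Std.Symm M.BraidStep := ⟨fun _ _ => BraidStep.symm M⟩
      exact symm h, fun h h' => h.trans h'⟩
  mul' {w x y z} h h' := by
    refine Relation.ReflTransGen.trans (b := x.toList ++ y.toList) ?_ ?_
    · refine h.lift (· ++ y.toList) fun a b hab => ?_
      simpa using BraidStep.append M hab [] y.toList
    · refine h'.lift (x.toList ++ ·) fun a b hab => ?_
      simpa using BraidStep.append M hab x.toList []

/-- The Artin monoid `A⁺(M)`. It is the quotient of words by chains of braid moves, rather than a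
`PresentedMonoid`, since the proof of cancellation is an induction on such chains. -/
def ArtinMonoid : Type _ := M.braidCon.Quotient

namespace ArtinMonoid

instance : Monoid M.ArtinMonoid := inferInstanceAs (Monoid M.braidCon.Quotient)

variable {M}

/-- The class of a word in the Artin monoid. -/
def ofWord (x : List B) : M.ArtinMonoid := M.braidCon.mk' (FreeMonoid.ofList x)

theorem ofWord_append (x y : List B) :
    (ofWord (x ++ y) : M.ArtinMonoid) = ofWord x * ofWord y := rfl

theorem ofWord_eq_iff {x y : List B} :
    (ofWord x : M.ArtinMonoid) = ofWord y ↔ Relation.ReflTransGen M.BraidStep x y :=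
  M.braidCon.eq

theorem exists_ofWord (a : M.ArtinMonoid) : ∃ x, ofWord x = a := by
  obtain ⟨x, rfl⟩ := M.braidCon.mk'_surjective a
  exact ⟨x.toList, rfl⟩

/-- The standard generators of the Artin monoid. -/
def gen (i : B) : M.ArtinMonoid := ofWord [i]

theorem ofWord_cons (i : B) (x : List B) :
    (ofWord (i :: x) : M.ArtinMonoid) = gen i * ofWord x := rfl

theorem ofWord_altWord (i j : B) (m : ℕ) :
    (ofWord (altWord i j m) : M.ArtinMonoid) = altProd (gen i) (gen j) m := by
  induction m generalizing i j with
  | zero => rfl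
  | succ m ih => rw [altWord, ofWord_cons, ih, altProd]

theorem ofWord_eq_of_step {x y : List B} (h : M.BraidStep x y) :
    (ofWord x : M.ArtinMonoid) = ofWord y := ofWord_eq_iff.mpr (.single h)

theorem altProd_gen_comm (i j : B) :
    altProd (gen i : M.ArtinMonoid) (gen j) (M i j) = altProd (gen j) (gen i) (M i j) := by
  by_cases hij : i = j
  · rw [hij]
  · have := ofWord_eq_of_step (BraidStep.intro (M := M) [] [] i j hij)
    simpa [ofWord_altWord] using this

theorem induction_gen {p : M.ArtinMonoid → Prop} (a : M.ArtinMonoid) (one : p 1)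
    (mul : ∀ i x, p x → p (gen i * x)) : p a := by
  obtain ⟨x, rfl⟩ := exists_ofWord a
  induction x with
  | nil => exact one
  | cons i x ih => exact mul i _ ih

/-- The universal property of the Artin monoid. -/
def lift {G : Type*} [Monoid G] (f : B → G)
    (hf : ∀ i j, i ≠ j → altProd (f i) (f j) (M i j) = altProd (f j) (f i) (M i j)) :
    M.ArtinMonoid →* G :=
  M.braidCon.lift (FreeMonoid.lift f) (by
    intro x y h
    change Relation.ReflTransGen M.BraidStep x.toList y.toList at h
    rw [Con.ker_rel, FreeMonoid.lift_apply, FreeMonoid.lift_apply]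
    generalize x.toList = u, y.toList = v at h
    induction h with
    | refl => rfl
    | tail _ h ih =>
      rw [ih]
      obtain ⟨p, q, i, j, hij⟩ := h
      simp only [List.map_append, List.prod_append, prod_map_altWord, hf i j hij])

theorem lift_ofWord {G : Type*} [Monoid G] (f : B → G) (hf) (x : List B) :
    lift (M := M) f hf (ofWord x) = (x.map f).prod :=
  FreeMonoid.lift_apply f (FreeMonoid.ofList x)

theorem lift_gen {G : Type*} [Monoid G] (f : B → G) (hf) (i : B) :
    lift (M := M) f hf (gen i) = f i := by
  rw [gen, lift_ofWord]
  simp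

/-- The common length of all the words that represent an element of the Artin monoid. -/
def degree (a : M.ArtinMonoid) : ℕ :=
  Multiplicative.toAdd (lift (M := M) (fun _ => Multiplicative.ofAdd 1) (fun _ _ _ => rfl) a)

theorem degree_mul (a b : M.ArtinMonoid) : degree (a * b) = degree a + degree b := by
  simp [degree]

theorem degree_one : degree (1 : M.ArtinMonoid) = 0 := by
  simp [degree]

theorem degree_gen (i : B) : degree (gen i : M.ArtinMonoid) = 1 := by
  simp [degree, lift_gen]

theorem degree_ofWord (x : List B) : degree (ofWord x : M.ArtinMonoid) = x.length := by
  induction x with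
  | nil => exact degree_one
  | cons i x ih => rw [ofWord_cons, degree_mul, ih, degree_gen, List.length_cons, add_comm]

variable (M) in
/-- The local form of divisibility: equal elements with first letters `i` and `j` agree after
cancellation when `i = j`, and both continue to the braid relation when `i ≠ j`. -/
def Complement (i j : B) (x y : M.ArtinMonoid) : Prop :=
  (i = j ∧ x = y) ∨ (i ≠ j ∧ ∃ z, x = altProd (gen j) (gen i) (M i j - 1) * z ∧
    y = altProd (gen i) (gen j) (M i j - 1) * z)

variable (M) in
/-- The cancellation and local divisibility property for elements `x` of degree less than `n`.
For all `n` it says that the Artin monoid is left cancellative and that two generators dividing an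
element have their braid as a common divisor of it. -/
def ReducesBelow (n : ℕ) : Prop :=
  ∀ (i j : B) (x y : M.ArtinMonoid), degree x < n → gen i * x = gen j * y → Complement M i j x y

theorem ReducesBelow.cancel_gen {n : ℕ} (H : ReducesBelow M n) {i : B} {x y : M.ArtinMonoid}
    (hn : degree (gen i * x) ≤ n) (h : gen i * x = gen i * y) : x = y := by
  rw [degree_mul, degree_gen] at hn
  rcases H i i x y (by omega) h with h | h
  · exact h.2
  · exact absurd rfl h.1

theorem ReducesBelow.cancel {n : ℕ} (H : ReducesBelow M n) {a x y : M.ArtinMonoid}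
    (hn : degree (a * x) ≤ n) (h : a * x = a * y) : x = y := by
  induction a using induction_gen with
  | one => simpa using h
  | mul i a ih =>
    rw [mul_assoc] at h hn
    rw [mul_assoc] at h
    refine ih ?_ (H.cancel_gen hn h)
    rw [degree_mul] at hn
    omega

end ArtinMonoid

end CoxeterMatrix

/-! ### Lifts of Coxeter group elements -/

namespace CoxeterSystem

open CoxeterMatrix CoxeterMatrix.ArtinMonoid

variable {B W : Type*} [Group W] {M : CoxeterMatrix B} (cs : CoxeterSystem M W)

local prefix:100 "s" => cs.simple
local prefix:100 "ℓ" => cs.length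

variable {cs} in
theorem isReduced_cons_iff {i : B} {x : List B} :
    cs.IsReduced (i :: x) ↔
      cs.IsReduced x ∧ cs.IsPrefix (s i) (s i * cs.wordProd x) := by
  rw [IsReduced, IsReduced, wordProd_cons, isPrefix_mul_iff, List.length_cons, length_simple]
  have := cs.length_wordProd_le x
  rcases cs.length_simple_mul (cs.wordProd x) i with h | h <;> omega

variable {cs} in
theorem isReduced_append {x y : List B} (hx : cs.IsReduced x) (hy : cs.IsReduced y)
    (h : cs.IsPrefix (cs.wordProd x) (cs.wordProd x * cs.wordProd y)) :
    cs.IsReduced (x ++ y) := by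
  rw [IsReduced, wordProd_append, isPrefix_mul_iff.mp h, hx.eq, hy.eq, List.length_append]

theorem wordProd_altWord (i j : B) (k : ℕ) :
    cs.wordProd (altWord i j k) = altProd (s i) (s j) k := prod_map_altWord _ _ _ _

theorem isReduced_altWord [Finite B] {i j : B} (hij : i ≠ j) {k : ℕ}
    (hk : M i j = 0 ∨ k ≤ M i j) : cs.IsReduced (altWord i j k) := by
  rw [IsReduced, wordProd_altWord, length_altWord, length_altProd cs hij hk]

/-- Matsumoto's theorem: two reduced words for the same element are related by braid moves. -/
theorem ofWord_eq_of_wordProd_eq [Finite B] [Finite W] (x y : List B) (hx : cs.IsReduced x)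
    (hy : cs.IsReduced y) (h : cs.wordProd x = cs.wordProd y) :
    (ofWord x : M.ArtinMonoid) = ofWord y := by
  induction hn : x.length generalizing x y with
  | zero =>
    have hy0 : y.length = 0 := by rw [← hy.eq, ← h, hx.eq, hn]
    rw [List.length_eq_zero_iff.mp hn, List.length_eq_zero_iff.mp hy0]
  | succ n ih =>
    have hyn : y.length = n + 1 := by rw [← hy.eq, ← h, hx.eq, hn]
    obtain ⟨i, x, rfl⟩ := List.exists_cons_of_length_eq_add_one hn
    obtain ⟨j, y, rfl⟩ := List.exists_cons_of_length_eq_add_one hyn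
    obtain ⟨hx', hix⟩ := isReduced_cons_iff.mp hx
    obtain ⟨hy', hjy⟩ := isReduced_cons_iff.mp hy
    rw [List.length_cons, Nat.add_right_cancel_iff] at hn hyn
    rw [← wordProd_cons] at hix hjy
    by_cases hij : i = j
    · subst hij
      rw [wordProd_cons, wordProd_cons, mul_right_inj] at h
      rw [ofWord_cons, ofWord_cons, ih x y hx' hy' h hn]
    · rw [← h] at hjy
      have hm0 := cs.matrix_ne_zero i j
      have hd := altProd_isPrefix hij hix hjy (k := M i j) (Or.inr le_rfl)
      obtain ⟨v, hv, hv'⟩ := cs.exists_isReduced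
        ((altProd (s i) (s j) (M i j))⁻¹ * cs.wordProd (i :: x))
      rw [inv_mul_eq_iff_eq_mul] at hv'
      have e1 : cs.wordProd (altWord i j (M i j) ++ v) = cs.wordProd (i :: x) := by
        rw [wordProd_append, wordProd_altWord, hv']
      have e2 : cs.wordProd (altWord j i (M i j) ++ v) = cs.wordProd (j :: y) := by
        rw [wordProd_append, wordProd_altWord, ← altProd_simple_comm, ← hv', h]
      have r1 : cs.IsReduced (altWord i j (M i j) ++ v) := by
        refine isReduced_append (cs.isReduced_altWord hij (Or.inr le_rfl)) hv ?_
        rwa [wordProd_altWord, ← hv']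
      have r2 : cs.IsReduced (altWord j i (M i j) ++ v) := by
        refine isReduced_append
          (cs.isReduced_altWord (Ne.symm hij) (Or.inr (M.symmetric i j).le)) hv ?_
        rwa [wordProd_altWord, ← altProd_simple_comm, ← hv']
      have key : (ofWord (altWord i j (M i j) ++ v) : M.ArtinMonoid) =
          ofWord (altWord j i (M i j) ++ v) := by
        rw [ofWord_append, ofWord_append, ofWord_altWord, ofWord_altWord, altProd_gen_comm]
      obtain ⟨m, hm⟩ := Nat.exists_eq_succ_of_ne_zero hm0
      rw [hm] at e1 e2 r1 r2 key
      have step : ∀ (a b : B) (u : List B), cs.IsReduced (a :: u) → u.length = n →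
          cs.IsReduced (altWord a b (m + 1) ++ v) →
          cs.wordProd (altWord a b (m + 1) ++ v) = cs.wordProd (a :: u) →
          (ofWord (a :: u) : M.ArtinMonoid) = ofWord (altWord a b (m + 1) ++ v) := by
        intro a b u hu hun hr he
        rw [altWord, List.cons_append] at hr he ⊢
        rw [wordProd_cons, wordProd_cons, mul_right_inj] at he
        rw [ofWord_cons, ofWord_cons,
          ih u _ (isReduced_cons_iff.mp hu).1 (isReduced_cons_iff.mp hr).1 he.symm hun]
      rw [step i j x hx hn r1 e1, key, ← step j i y hy hyn r2 e2]

/-- The lift of an element of a Coxeter group to the Artin monoid through a reduced word. By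
Matsumoto's theorem it does not depend on the word. -/
noncomputable def posLift (w : W) : M.ArtinMonoid := ofWord (cs.exists_isReduced w).choose

theorem posLift_wordProd [Finite B] [Finite W] {x : List B} (hx : cs.IsReduced x) :
    cs.posLift (cs.wordProd x) = ofWord x :=
  cs.ofWord_eq_of_wordProd_eq _ _ (cs.exists_isReduced (cs.wordProd x)).choose_spec.1 hx
    (cs.exists_isReduced (cs.wordProd x)).choose_spec.2.symm

theorem degree_posLift (w : W) : degree (cs.posLift w) = ℓ w := by
  have h := (cs.exists_isReduced w).choose_spec
  rw [posLift, degree_ofWord, ← h.1.eq, ← h.2]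

variable {cs} in
theorem IsPrefix.simple_mul {i : B} {a k : W} (ha : cs.IsPrefix (s i) a)
    (h : cs.IsPrefix a k) : cs.IsPrefix (s i * a) (s i * k) := by
  refine IsPrefix.of_mul_left (a := s i) ?_ ?_ <;>
    simpa only [simple_mul_simple_cancel_left]

variable [Finite B] [Finite W]

theorem posLift_one : cs.posLift 1 = 1 :=
  cs.posLift_wordProd (x := []) (by simp [IsReduced])

theorem posLift_simple (i : B) : cs.posLift (s i) = gen i := by
  have := cs.posLift_wordProd (x := [i]) (by simp [IsReduced])
  rwa [wordProd_singleton] at this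

theorem posLift_altProd {i j : B} (hij : i ≠ j) {k : ℕ} (hk : k ≤ M i j) :
    cs.posLift (altProd (s i) (s j) k) = altProd (gen i) (gen j) k := by
  rw [← ofWord_altWord, ← wordProd_altWord,
    posLift_wordProd cs (cs.isReduced_altWord hij (Or.inr hk))]

variable {cs}

theorem IsPrefix.posLift_mul {a x : W} (h : cs.IsPrefix a (a * x)) :
    cs.posLift (a * x) = cs.posLift a * cs.posLift x := by
  obtain ⟨u, hu, rfl⟩ := cs.exists_isReduced a
  obtain ⟨v, hv, rfl⟩ := cs.exists_isReduced x
  rw [← wordProd_append, posLift_wordProd cs (isReduced_append hu hv h), posLift_wordProd cs hu,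
    posLift_wordProd cs hv, ofWord_append]

theorem IsPrefix.posLift_eq {a w : W} (h : cs.IsPrefix a w) :
    cs.posLift w = cs.posLift a * cs.posLift (a⁻¹ * w) := by
  rw [← IsPrefix.posLift_mul (by rwa [mul_inv_cancel_left]), mul_inv_cancel_left]

theorem IsPrefix.posLift_eq_gen_mul {i : B} {w : W} (h : cs.IsPrefix (s i) w) :
    cs.posLift w = gen i * cs.posLift (s i * w) := by
  rw [h.posLift_eq, posLift_simple, inv_simple]

/-- Simple divisors of an element of the Artin monoid that have a common bound
in the weak order have a common multiple among the simple divisors below that bound. -/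
theorem exists_common_posLift_dvd {n : ℕ} (H : ReducesBelow M n) (w : M.ArtinMonoid)
    (hw : degree w ≤ n) (k a b : W) (ha : cs.IsPrefix a k) (hb : cs.IsPrefix b k)
    (haw : cs.posLift a ∣ w) (hbw : cs.posLift b ∣ w) :
    ∃ c, cs.IsPrefix a c ∧ cs.IsPrefix b c ∧ cs.IsPrefix c k ∧ cs.posLift c ∣ w := by
  induction hN : degree w using Nat.strong_induction_on generalizing w k a b with
  | _ N ih =>
  have same : ∀ (i : B) (a b : W), cs.IsPrefix (s i) a → cs.IsPrefix (s i) b →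
      cs.IsPrefix a k → cs.IsPrefix b k → cs.posLift a ∣ w → cs.posLift b ∣ w →
      ∃ c, cs.IsPrefix a c ∧ cs.IsPrefix b c ∧ cs.IsPrefix c k ∧ cs.posLift c ∣ w := by
    rintro i a b hia hib ha hb ⟨u, hu⟩ ⟨v, hv⟩
    have hu' := hu
    rw [hia.posLift_eq_gen_mul, mul_assoc] at hu
    rw [hib.posLift_eq_gen_mul, mul_assoc] at hv
    have e := H.cancel_gen (hu ▸ hw) (hu.symm.trans hv)
    have hdeg := congrArg degree hu
    rw [degree_mul, degree_gen] at hdeg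
    have hik : cs.IsPrefix (s i) k := hia.trans ha
    obtain ⟨c, h1, h2, h3, h4⟩ := ih _ (by omega) (cs.posLift (s i * a) * u) (by omega)
      (s i * k) (s i * a) (s i * b) (hia.simple_mul ha) (hib.simple_mul hb)
      (Dvd.intro _ rfl) (e ▸ Dvd.intro _ rfl) rfl
    have hik' : cs.IsPrefix (s i) (s i * (s i * k)) := by
      rwa [simple_mul_simple_cancel_left]
    have hc := h3.mul_left_of_prefix hik'
    refine ⟨s i * c, ?_, ?_, ?_, ?_⟩
    · simpa only [simple_mul_simple_cancel_left] using h1.mul_left hc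
    · simpa only [simple_mul_simple_cancel_left] using h2.mul_left hc
    · simpa only [simple_mul_simple_cancel_left] using h3.mul_left hik'
    · rw [hc.posLift_mul, posLift_simple, hu]
      exact mul_dvd_mul_left _ h4
  by_cases ha1 : a = 1
  · subst ha1
    exact ⟨b, one_isPrefix b, isPrefix_refl b, hb, hbw⟩
  by_cases hb1 : b = 1
  · subst hb1
    exact ⟨a, isPrefix_refl a, one_isPrefix a, ha, haw⟩
  obtain ⟨i, hi⟩ := exists_simple_isPrefix (cs := cs) ha1
  obtain ⟨j, hj⟩ := exists_simple_isPrefix (cs := cs) hb1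
  by_cases hij : i = j
  · subst hij
    exact same i a b hi hj ha hb haw hbw
  · obtain ⟨u, hu⟩ := id haw
    obtain ⟨v, hv⟩ := id hbw
    rw [hi.posLift_eq_gen_mul, mul_assoc] at hu
    rw [hj.posLift_eq_gen_mul, mul_assoc] at hv
    have hdeg := congrArg degree hu
    rw [degree_mul, degree_gen] at hdeg
    have hm0 := cs.matrix_ne_zero i j
    rcases H i j _ _ (by omega) (hu.symm.trans hv) with h | ⟨-, z, hz, -⟩
    · exact absurd h.1 hij
    have hdk := altProd_isPrefix hij (hi.trans ha) (hj.trans hb) (k := M i j) (Or.inr le_rfl)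
    have hid : cs.IsPrefix (s i) (altProd (s i) (s j) (M i j)) := by
      rw [← mul_altProd_pred _ _ hm0, isPrefix_mul_iff, mul_altProd_pred _ _ hm0,
        length_altProd cs hij (Or.inr le_rfl), length_altProd cs (Ne.symm hij)
        (Or.inr (by rw [M.symmetric]; omega)), length_simple]
      omega
    have hjd : cs.IsPrefix (s j) (altProd (s i) (s j) (M i j)) := by
      rw [altProd_simple_comm, ← mul_altProd_pred _ _ hm0, isPrefix_mul_iff,
        mul_altProd_pred _ _ hm0, length_altProd cs (Ne.symm hij)
        (Or.inr (by rw [M.symmetric])), length_altProd cs hij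
        (Or.inr (by omega)), length_simple]
      omega
    have hdw : cs.posLift (altProd (s i) (s j) (M i j)) ∣ w := by
      rw [posLift_altProd cs hij le_rfl, hu, hz, ← mul_assoc, mul_altProd_pred _ _ hm0]
      exact Dvd.intro _ rfl
    obtain ⟨c, h1, h2, h3, h4⟩ := same i a _ hi hid ha hdk haw hdw
    obtain ⟨c', h5, h6, h7, h8⟩ := same j c b (hjd.trans h2) hj h3 hb h4 hbw
    exact ⟨c', h1.trans h5, h6, h7, h8⟩

end CoxeterSystem

/-! ### Cancellation in the Artin monoid -/

namespace CoxeterSystem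

open CoxeterMatrix CoxeterMatrix.ArtinMonoid

variable {B W : Type*} [Group W] {M : CoxeterMatrix B} (cs : CoxeterSystem M W)

local prefix:100 "s" => cs.simple
local prefix:100 "ℓ" => cs.length

variable [Finite B] [Finite W]

theorem simple_isPrefix_altProd {i j : B} (hij : i ≠ j) :
    cs.IsPrefix (s i) (altProd (s i) (s j) (M i j)) := by
  have hm0 := cs.matrix_ne_zero i j
  have h1 := cs.length_altProd hij (k := M i j) (Or.inr le_rfl)
  have h2 := cs.length_altProd (Ne.symm hij) (k := M i j - 1) (Or.inr (by rw [M.symmetric]; omega))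
  rw [← mul_altProd_pred _ _ hm0] at h1 ⊢
  rw [isPrefix_mul_iff, h1, h2, length_simple]
  omega

theorem simple_mul_altProd (i j : B) :
    s i * altProd (s i) (s j) (M i j) = altProd (s j) (s i) (M i j - 1) := by
  rw [← mul_altProd_pred _ _ (cs.matrix_ne_zero i j), simple_mul_simple_cancel_left]

theorem altProd_pred_isPrefix {i j : B} (hij : i ≠ j) {w : W}
    (h : cs.IsPrefix (altProd (s i) (s j) (M i j)) w) :
    cs.IsPrefix (altProd (s j) (s i) (M i j - 1)) (s i * w) := by
  rw [← simple_mul_altProd]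
  exact (cs.simple_isPrefix_altProd hij).simple_mul h

variable {cs}

theorem posLift_of_altProd_isPrefix {i j : B} (hij : i ≠ j) {w : W}
    (h : cs.IsPrefix (altProd (s i) (s j) (M i j)) w) :
    cs.posLift (s i * w) = altProd (gen j) (gen i) (M i j - 1) *
      cs.posLift ((altProd (s i) (s j) (M i j))⁻¹ * w) := by
  rw [(cs.altProd_pred_isPrefix hij h).posLift_eq,
    cs.posLift_altProd (Ne.symm hij) (by rw [M.symmetric]; omega), ← simple_mul_altProd, mul_inv_rev,
    inv_simple]
  simp only [mul_assoc, simple_mul_simple_cancel_left]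

/-- If the lift of `c` is the initial part of an element that starts with the braid of `a` and `b`
without its first letter `b`, then putting `b` in front and removing `a` is a computation
in the Coxeter group. -/
theorem altProd_mul_of_cancel {n : ℕ} (H : ReducesBelow M n) {a b : B} (hab : a ≠ b)
    {c : W} {q r : M.ArtinMonoid} (hc : cs.IsPrefix (altProd (s a) (s b) (M a b - 1)) c)
    (hb : cs.IsPrefix (s b) (s b * c))
    (hdeg : degree (altProd (gen a) (gen b) (M a b - 1) * q) ≤ n)
    (h : altProd (gen a) (gen b) (M a b - 1) * q = cs.posLift c * r) :
    cs.IsPrefix (s a) (s b * c) ∧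
      altProd (gen b) (gen a) (M a b - 1) * q = cs.posLift (s a * (s b * c)) * r := by
  have hm0 := cs.matrix_ne_zero a b
  have hpre : cs.IsPrefix (altProd (s a) (s b) (M a b)) (s b * c) := by
    rw [altProd_simple_comm, ← mul_altProd_pred _ _ hm0]
    exact hc.mul_left hb
  refine ⟨(cs.simple_isPrefix_altProd hab).trans hpre, ?_⟩
  rw [hc.posLift_eq, cs.posLift_altProd hab (by omega), mul_assoc] at h
  rw [posLift_of_altProd_isPrefix hab hpre, mul_assoc, H.cancel hdeg h]
  congr 3
  rw [altProd_simple_comm, ← mul_altProd_pred _ _ hm0, mul_inv_rev, inv_simple]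
  simp only [mul_assoc, simple_mul_simple_cancel_left]

/-- The cube condition for three generators. The two braids through `b` have a common multiple
among the simple divisors, bounded by `s b * w₀`; putting `b` back in front gives an element of the
Coxeter group with `a` and `j` as left descents, hence a multiple of the braid of `a` and `j`. -/
theorem complement_of_cube (cs : CoxeterSystem M W) {n : ℕ} (H : ReducesBelow M n) {a b j : B} (hab : a ≠ b) (hjb : j ≠ b)
    (haj : a ≠ j) {q z : M.ArtinMonoid}
    (hdeg : degree (altProd (gen a) (gen b) (M a b - 1) * q) ≤ n)
    (h : altProd (gen a) (gen b) (M a b - 1) * q = altProd (gen j) (gen b) (M j b - 1) * z) :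
    Complement M a j (altProd (gen b) (gen a) (M a b - 1) * q)
      (altProd (gen b) (gen j) (M j b - 1) * z) := by
  have hbk : cs.IsPrefix (cs.simple b) (cs.simple b * (cs.simple b * cs.longest)) := by
    rw [simple_mul_simple_cancel_left]
    exact cs.isPrefix_longest _
  have hpre : ∀ a, a ≠ b → cs.IsPrefix (altProd (cs.simple a) (cs.simple b) (M a b - 1)) (cs.simple b * cs.longest) := by
    intro a hab
    have := cs.altProd_pred_isPrefix (Ne.symm hab) (cs.isPrefix_longest _)
    rwa [M.symmetric] at this
  have hdvd : ∀ a, a ≠ b → ∀ q : M.ArtinMonoid, cs.posLift (altProd (cs.simple a) (cs.simple b) (M a b - 1)) ∣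
      altProd (gen a) (gen b) (M a b - 1) * q := by
    intro a hab q
    rw [cs.posLift_altProd hab (by omega)]
    exact Dvd.intro _ rfl
  obtain ⟨c, hac, hjc, hck, r, hr⟩ := exists_common_posLift_dvd H _ hdeg _ _ _ (hpre a hab)
    (hpre j hjb) (hdvd a hab q) (h ▸ hdvd j hjb z)
  have hbc : cs.IsPrefix (cs.simple b) (cs.simple b * c) := hck.mul_left_of_prefix hbk
  obtain ⟨h1, e1⟩ := altProd_mul_of_cancel H hab hac hbc hdeg hr
  obtain ⟨h2, e2⟩ := altProd_mul_of_cancel H hjb hjc hbc (h ▸ hdeg) (h ▸ hr)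
  have hd := altProd_isPrefix haj h1 h2 (k := M a j) (Or.inr le_rfl)
  refine Or.inr ⟨haj, cs.posLift ((altProd (cs.simple a) (cs.simple j) (M a j))⁻¹ * (cs.simple b * c)) * r, ?_, ?_⟩
  · rw [e1, posLift_of_altProd_isPrefix haj hd, mul_assoc]
  · rw [altProd_simple_comm, M.symmetric] at hd
    rw [e2, posLift_of_altProd_isPrefix haj.symm hd, mul_assoc, altProd_simple_comm,
      M.symmetric j a]

/-- The inductive step for `ReducesBelow`, by induction on the chain of braid moves. Moves that
touch the first letter are composed by means of the cube condition. -/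
theorem complement_of_chain (cs : CoxeterSystem M W) {n : ℕ} (H : ReducesBelow M n)
    {i j : B} {x y : List B} (hx : x.length ≤ n)
    (h : Relation.ReflTransGen M.BraidStep (i :: x) (j :: y)) :
    Complement M i j (ofWord x) (ofWord y) := by
  generalize hv : i :: x = v at h
  induction h using Relation.ReflTransGen.head_induction_on generalizing i x with
  | refl =>
    obtain ⟨rfl, rfl⟩ := List.cons.inj hv
    exact Or.inl ⟨rfl, rfl⟩
  | head hstep _ ih =>
    obtain ⟨p, q, a, b, hab⟩ := hstep
    have hm0 := cs.matrix_ne_zero a b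
    cases p with
    | cons i' p =>
      obtain ⟨rfl, rfl⟩ := List.cons.inj hv
      have e : (ofWord (p ++ (altWord a b (M a b) ++ q)) : M.ArtinMonoid) =
          ofWord (p ++ (altWord b a (M a b) ++ q)) := ofWord_eq_of_step ⟨p, q, a, b, hab⟩
      change Complement M i j (ofWord (p ++ (altWord a b (M a b) ++ q))) (ofWord y)
      rw [e]
      refine ih (le_of_eq_of_le ?_ hx) rfl
      simp [length_altWord]
    | nil =>
      obtain ⟨m, hm⟩ := Nat.exists_eq_succ_of_ne_zero hm0
      rw [hm, altWord, List.nil_append, List.cons_append] at hv ih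
      obtain ⟨rfl, rfl⟩ := List.cons.inj hv
      have hlen : (altWord i b m ++ q).length ≤ n := by
        simpa [length_altWord] using hx
      have key := ih hlen rfl
      rw [ofWord_append, ofWord_altWord] at key
      rw [ofWord_append, ofWord_altWord]
      have hm' : m = M i b - 1 := by omega
      have hdeg : degree (altProd (gen i) (gen b) m * ofWord q : M.ArtinMonoid) ≤ n := by
        rwa [← ofWord_altWord, ← ofWord_append, degree_ofWord]
      subst hm'
      rcases key with ⟨rfl, e⟩ | ⟨hbj, z, e1, e2⟩
      · exact Or.inr ⟨hab, ofWord q, rfl, e.symm⟩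
      · rw [M.symmetric b j] at e1 e2
        rw [e2]
        by_cases hij : i = j
        · subst hij
          exact Or.inl ⟨rfl, by rw [H.cancel hdeg e1]⟩
        · exact complement_of_cube cs H hab (Ne.symm hbj) hij hdeg e1

theorem reducesBelow (cs : CoxeterSystem M W) (n : ℕ) : ReducesBelow M n := by
  induction n with
  | zero => intro i j x y hx; omega
  | succ n ih =>
    intro i j x y hx h
    obtain ⟨x, rfl⟩ := exists_ofWord x
    obtain ⟨y, rfl⟩ := exists_ofWord y
    rw [degree_ofWord] at hx
    exact complement_of_chain cs ih (by omega) (ofWord_eq_iff.mp h)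

end CoxeterSystem

/-! ### The Garside element -/

namespace CoxeterMatrix.ArtinMonoid

open CoxeterSystem

variable {B : Type*} [Finite B] {M : CoxeterMatrix B} [Finite M.Group]

theorem complement_of_eq {i j : B} {x y : M.ArtinMonoid} (h : gen i * x = gen j * y) :
    Complement M i j x y :=
  reducesBelow M.toCoxeterSystem _ i j x y (Nat.lt_succ_self _) h

theorem mul_left_cancel' {a x y : M.ArtinMonoid} (h : a * x = a * y) : x = y :=
  (reducesBelow M.toCoxeterSystem _).cancel le_rfl h

variable (M) in
/-- The Garside element: the lift of the longest element, and the least common multiple of the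
generators. -/
noncomputable def garside : M.ArtinMonoid := M.toCoxeterSystem.posLift M.toCoxeterSystem.longest

theorem gen_dvd_garside (i : B) : gen i ∣ garside M :=
  ⟨_, (M.toCoxeterSystem.isPrefix_longest (M.toCoxeterSystem.simple i)).posLift_eq_gen_mul⟩

theorem garside_dvd {a : M.ArtinMonoid} (h : ∀ i, gen i ∣ a) : garside M ∣ a := by
  have key : ∀ S : Set B, S.Finite → ∃ c, (∀ i ∈ S, M.toCoxeterSystem.IsPrefix
      (M.toCoxeterSystem.simple i) c) ∧ M.toCoxeterSystem.posLift c ∣ a := by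
    intro S hS
    induction S, hS using Set.Finite.induction_on with
    | empty => exact ⟨1, by simp, by rw [posLift_one]; exact one_dvd a⟩
    | insert _ _ ih =>
      rename_i i S _ _
      obtain ⟨c, hc, hca⟩ := ih
      obtain ⟨c', h1, h2, -, h4⟩ := exists_common_posLift_dvd
        (reducesBelow M.toCoxeterSystem _) a le_rfl M.toCoxeterSystem.longest c
        (M.toCoxeterSystem.simple i) (isPrefix_longest _ _) (isPrefix_longest _ _) hca
        (by rw [posLift_simple]; exact h i)
      refine ⟨c', ?_, h4⟩
      rintro k (rfl | hk)
      · exact h2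
      · exact (hc k hk).trans h1
  obtain ⟨c, hc, hca⟩ := key Set.univ Set.finite_univ
  rwa [eq_longest_of_forall_isPrefix fun i => hc i (Set.mem_univ i)] at hca

theorem exists_gen_mul_garside (i : B) : ∃ j, gen i * garside M = garside M * gen j ∧
    gen j * garside M = garside M * gen i := by
  set cs := M.toCoxeterSystem with hcs
  obtain ⟨j, hj⟩ := cs.exists_longest_conj_simple i
  have key : ∀ i j, cs.simple i * cs.longest = cs.longest * cs.simple j →
      gen i * garside M = garside M * gen j := by
    intro i j hj
    have h1 : garside M = gen i * cs.posLift (cs.simple i * cs.longest) :=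
      (cs.isPrefix_longest (cs.simple i)).posLift_eq_gen_mul
    have h2 : garside M = cs.posLift (cs.longest * cs.simple j) * gen j := by
      have h := (cs.isPrefix_longest (cs.longest * cs.simple j)).posLift_eq
      rwa [mul_inv_rev, inv_simple, mul_assoc, cs.longest_inv, cs.longest_mul_self, mul_one,
        posLift_simple] at h
    conv_lhs => rw [h2]
    conv_rhs => rw [h1]
    rw [hj, mul_assoc]
  refine ⟨j, key i j hj, key j i ?_⟩
  have := congrArg (fun w => cs.longest * w * cs.longest) hj
  simp only [mul_assoc, cs.longest_mul_self, mul_one] at this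
  rw [← mul_assoc cs.longest cs.longest, cs.longest_mul_self, one_mul] at this
  exact this.symm

theorem commute_garside_sq (a : M.ArtinMonoid) : Commute (garside M ^ 2) a := by
  induction a using induction_gen with
  | one => exact Commute.one_right _
  | mul i x ih =>
    refine Commute.mul_right ?_ ih
    obtain ⟨j, h1, h2⟩ := exists_gen_mul_garside (M := M) i
    rw [Commute, SemiconjBy, pow_two, mul_assoc, ← h2, ← mul_assoc, ← h1, mul_assoc]

theorem exists_mul_eq_garside_pow (a : M.ArtinMonoid) :
    ∃ (b : M.ArtinMonoid) (n : ℕ), a * b = (garside M ^ 2) ^ n ∧ b * a = (garside M ^ 2) ^ n := by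
  obtain ⟨b, n, h⟩ : ∃ (b : M.ArtinMonoid) (n : ℕ), a * b = (garside M ^ 2) ^ n := by
    induction a using induction_gen with
    | one => exact ⟨1, 0, by simp⟩
    | mul i x ih =>
      obtain ⟨b, n, hb⟩ := ih
      obtain ⟨c, hc⟩ := gen_dvd_garside (M := M) i
      refine ⟨b * (c * garside M), n + 1, ?_⟩
      rw [show gen i * x * (b * (c * garside M)) = gen i * (x * b) * (c * garside M) by
        simp only [mul_assoc], hb, ← ((commute_garside_sq (gen i)).pow_left n).eq, mul_assoc,
        ← mul_assoc (gen i), ← hc, ← pow_two, ← pow_succ]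
  refine ⟨b, n, h, mul_left_cancel' (a := a) ?_⟩
  rw [← mul_assoc, h, ((commute_garside_sq a).pow_left n).eq]

/-- Right cancellation follows from left cancellation, because the square of the Garside element
is central and a multiple of every generator on either side. -/
theorem mul_right_cancel' {a x y : M.ArtinMonoid} (h : x * a = y * a) : x = y := by
  obtain ⟨b, n, hb, -⟩ := exists_mul_eq_garside_pow a
  have := congrArg (· * b) h
  simp only [mul_assoc, hb] at this
  rw [← ((commute_garside_sq x).pow_left n).eq, ← ((commute_garside_sq y).pow_left n).eq] at this
  exact mul_left_cancel' this

/-- Quasi-central elements of the Artin monoid: those that permute the generators by conjugation.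
Removing a factor `Δ` from a central element leaves an element that need only be quasi-central. -/
def IsQuasiCentral (a : M.ArtinMonoid) : Prop := ∀ i, ∃ j, gen i * a = a * gen j

/-- Divisibility of a quasi-central element by generators spreads along the edges of the Coxeter
graph. -/
theorem IsQuasiCentral.gen_dvd {a : M.ArtinMonoid} (ha : IsQuasiCentral a)
    (hirr : M.IsIrreducible) {i : B} (hi : gen i ∣ a) (j : B) : gen j ∣ a := by
  have step : ∀ i j, M.coxeterGraph.Adj i j → gen i ∣ a → gen j ∣ a := by
    rintro i j ⟨hij, hm2⟩ ⟨x, hx⟩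
    have hm0 := M.toCoxeterSystem.matrix_ne_zero i j
    have hm := M.two_le_of_ne hij hm0
    obtain ⟨j', hj'⟩ := ha j
    obtain ⟨i', hi'⟩ := ha i
    have e : gen i * (x * gen j') = gen j * a := by rw [hj', hx, mul_assoc]
    rcases complement_of_eq e with h | ⟨-, z, -, hz⟩
    · exact absurd h.1 hij
    · obtain ⟨m, hm'⟩ : ∃ m, M i j - 1 = m + 2 := ⟨M i j - 3, by omega⟩
      rw [hm', altProd, altProd, mul_assoc, mul_assoc] at hz
      have hx' : x = gen j * (altProd (gen i) (gen j) m * z) := mul_left_cancel' (hx.symm.trans hz)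
      rw [hx, mul_assoc] at hi'
      have := mul_left_cancel' hi'
      rw [← hx, hx', mul_assoc] at this
      exact ⟨_, this⟩
  obtain ⟨p⟩ := hirr.preconnected i j
  induction p with
  | nil => exact hi
  | cons h _ ih => exact ih (step _ _ h hi)

theorem IsQuasiCentral.exists_eq_garside_pow {a : M.ArtinMonoid} (ha : IsQuasiCentral a)
    (hirr : M.IsIrreducible) : ∃ n, a = garside M ^ n := by
  induction hN : degree a using Nat.strong_induction_on generalizing a with
  | _ N ih =>
  obtain ⟨x, rfl⟩ := exists_ofWord a
  cases x with
  | nil => exact ⟨0, rfl⟩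
  | cons i x =>
    obtain ⟨b, hb⟩ := garside_dvd fun j => ha.gen_dvd hirr ⟨ofWord x, ofWord_cons i x⟩ j
    rw [hb] at ha hN ⊢
    have hpos : 0 < degree (garside M) := by
      obtain ⟨c, hc⟩ := gen_dvd_garside (M := M) i
      rw [hc, degree_mul, degree_gen]
      omega
    rw [degree_mul] at hN
    obtain ⟨n, rfl⟩ := ih (degree b) (by omega) (a := b) (by
      intro i
      obtain ⟨j, h1, h2⟩ := exists_gen_mul_garside (M := M) i
      obtain ⟨k, hk⟩ := ha j
      refine ⟨k, mul_left_cancel' (a := garside M) ?_⟩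
      rw [← mul_assoc, ← h2, mul_assoc, hk, mul_assoc]) rfl
    exact ⟨n + 1, (pow_succ' _ _).symm⟩

theorem le_degree_garside (i j : B) (hij : i ≠ j) : M i j ≤ degree (garside M) := by
  have := M.toCoxeterSystem.length_le_longest (altProd (M.toCoxeterSystem.simple i)
    (M.toCoxeterSystem.simple j) (M i j))
  rwa [length_altProd _ hij (Or.inr le_rfl), ← M.toCoxeterSystem.degree_posLift (longest _)] at this

/-- The Artin monoid satisfies the Ore condition, with powers of `Δ ^ 2` as denominators. -/
noncomputable instance : OreLocalization.OreSet (⊤ : Submonoid M.ArtinMonoid) where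
  ore_right_cancel x y a h := ⟨1, by rw [mul_right_cancel' h]⟩
  oreNum r a := r * (exists_mul_eq_garside_pow (a : M.ArtinMonoid)).choose
  oreDenom _ a := ⟨(garside M ^ 2) ^
    (exists_mul_eq_garside_pow (a : M.ArtinMonoid)).choose_spec.choose, Submonoid.mem_top _⟩
  ore_eq r a := by
    have h := (exists_mul_eq_garside_pow (a : M.ArtinMonoid)).choose_spec.choose_spec.2
    exact ((commute_garside_sq r).pow_left _).trans
      ((congrArg (r * ·) h.symm).trans (mul_assoc _ _ _).symm)

end CoxeterMatrix.ArtinMonoid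

/-! ### The centre of the Artin group -/

namespace CoxeterMatrix

open ArtinMonoid

variable {B : Type*} {M : CoxeterMatrix B}

theorem artin_relation (i j : B) (hij : i ≠ j) :
    altProd (PresentedGroup.of i : M.ArtinGroup) (PresentedGroup.of j) (M i j) =
      altProd (PresentedGroup.of j) (PresentedGroup.of i) (M i j) := by
  by_cases h0 : M i j = 0
  · rw [h0]; rfl
  · have h : PresentedGroup.mk M.artinRelators (altProd (FreeGroup.of i) (FreeGroup.of j) (M i j) *
      (altProd (FreeGroup.of j) (FreeGroup.of i) (M i j))⁻¹) = 1 :=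
      PresentedGroup.one_of_mem ⟨i, j, hij, h0, rfl⟩
    rw [map_mul, map_inv, map_altProd, map_altProd] at h
    exact mul_inv_eq_one.mp h

variable (M) in
/-- The canonical homomorphism `A⁺(M) → A(M)`. -/
def monoidToGroup : M.ArtinMonoid →* M.ArtinGroup :=
  ArtinMonoid.lift PresentedGroup.of artin_relation

theorem monoidToGroup_gen (i : B) : monoidToGroup M (gen i) = PresentedGroup.of i :=
  lift_gen _ _ i

theorem artinLength_monoidToGroup (a : M.ArtinMonoid) :
    M.artinLength (monoidToGroup M a) = Multiplicative.ofAdd (degree a : ℤ) := by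
  induction a using induction_gen with
  | one => simp [degree_one]
  | mul i x ih =>
    rw [map_mul, map_mul, ih, monoidToGroup_gen, degree_mul, degree_gen, artinLength,
      PresentedGroup.toGroup.of]
    push_cast
    rfl

section

variable [Finite B] [Finite M.Group]

/-- The Artin monoid embeds into its group, since it embeds into its monoid of fractions, where
the generators are invertible and satisfy the Artin relations. -/
theorem monoidToGroup_injective : Function.Injective (monoidToGroup M) := by
  let φ : M.ArtinGroup →* (OreLocalization (⊤ : Submonoid M.ArtinMonoid) M.ArtinMonoid)ˣ :=
    PresentedGroup.toGroup
      (f := fun i => OreLocalization.numeratorUnit ⟨gen i, Submonoid.mem_top _⟩) (by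
        rintro r ⟨i, j, -, -, rfl⟩
        rw [map_mul, map_inv, mul_inv_eq_one, map_altProd, map_altProd, FreeGroup.lift_apply_of,
          FreeGroup.lift_apply_of]
        apply Units.ext
        have h := congrArg (OreLocalization.numeratorHom (S := (⊤ : Submonoid M.ArtinMonoid)))
          (altProd_gen_comm (M := M) i j)
        rw [map_altProd, map_altProd] at h
        have e : ∀ u : _ˣ, (u : OreLocalization (⊤ : Submonoid M.ArtinMonoid) M.ArtinMonoid) =
          Units.coeHom _ u := fun _ => rfl
        rw [e, e, map_altProd, map_altProd]
        exact h)
  have hφ : ∀ a, ((φ (monoidToGroup M a) : _ˣ) :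
      OreLocalization (⊤ : Submonoid M.ArtinMonoid) M.ArtinMonoid) =
        OreLocalization.numeratorHom a := by
    intro a
    induction a using induction_gen with
    | one => rw [map_one, map_one, map_one]; rfl
    | mul i x ih =>
      rw [map_mul, map_mul, map_mul, Units.val_mul, ih, monoidToGroup_gen, PresentedGroup.toGroup.of]
      rfl
  intro a b h
  have h' : OreLocalization.numeratorHom (S := (⊤ : Submonoid M.ArtinMonoid)) a =
      OreLocalization.numeratorHom b := by rw [← hφ, ← hφ, h]
  obtain ⟨u, v, h1, h2⟩ := OreLocalization.oreDiv_eq_iff.mp h'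
  simp only [Submonoid.coe_one, mul_one] at h2
  change (u : M.ArtinMonoid) * b = v * a at h1
  rw [h2] at h1
  exact (mul_left_cancel' h1).symm

variable (M) in
/-- The image `Δ` of the Garside element in the Artin group. -/
noncomputable def garsideElement : M.ArtinGroup := monoidToGroup M (garside M)

theorem garsideElement_sq_mem_center : garsideElement M ^ 2 ∈ Subgroup.center M.ArtinGroup := by
  rw [Subgroup.mem_center_iff]
  intro g
  have hg : g ∈ Subgroup.closure (Set.range PresentedGroup.of) :=
    PresentedGroup.closure_range_of M.artinRelators ▸ Subgroup.mem_top g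
  change Commute g _
  induction hg using Subgroup.closure_induction with
  | mem x hx =>
    obtain ⟨i, rfl⟩ := hx
    have h := congrArg (monoidToGroup M) (commute_garside_sq (gen i)).eq
    rw [map_mul, map_mul, map_pow, monoidToGroup_gen] at h
    exact h.symm
  | one => exact Commute.one_left _
  | mul x y _ _ hx hy => exact hx.mul_left hy
  | inv x _ hx => exact hx.inv_left

/-- Every element of the Artin group is a positive element divided by a central power of `Δ ^ 2`. -/
theorem exists_garsideElement_pow_mul (g : M.ArtinGroup) :
    ∃ (n : ℕ) (a : M.ArtinMonoid), (garsideElement M ^ 2) ^ n * g = monoidToGroup M a := by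
  have hg : g ∈ Subgroup.closure (Set.range PresentedGroup.of) :=
    PresentedGroup.closure_range_of M.artinRelators ▸ Subgroup.mem_top g
  induction hg using Subgroup.closure_induction_right with
  | one => exact ⟨0, 1, by simp⟩
  | mul_right x _ y hy ih =>
    obtain ⟨n, a, ha⟩ := ih
    obtain ⟨i, rfl⟩ := hy
    exact ⟨n, a * gen i, by rw [← mul_assoc, ha, map_mul, monoidToGroup_gen]⟩
  | mul_inv_cancel x _ y hy ih =>
    obtain ⟨n, a, ha⟩ := ih
    obtain ⟨i, rfl⟩ := hy
    obtain ⟨c, m, hc, -⟩ := exists_mul_eq_garside_pow (gen i : M.ArtinMonoid)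
    refine ⟨n + m, a * c, ?_⟩
    have hc' := congrArg (monoidToGroup M) hc
    rw [map_mul, map_pow, map_pow, monoidToGroup_gen] at hc'
    have hcomm := Subgroup.mem_center_iff.mp (pow_mem (garsideElement_sq_mem_center (M := M)) m)
    rw [map_mul, ← ha, pow_add, mul_assoc, ← hcomm, eq_inv_mul_of_mul_eq hc', garsideElement]
    simp only [mul_assoc]

theorem center_le_zpowers (hirr : M.IsIrreducible) :
    Subgroup.center M.ArtinGroup ≤ Subgroup.zpowers (garsideElement M) := by
  intro g hg
  obtain ⟨n, a, ha⟩ := exists_garsideElement_pow_mul g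
  have hc : monoidToGroup M a ∈ Subgroup.center M.ArtinGroup :=
    ha ▸ mul_mem (pow_mem garsideElement_sq_mem_center n) hg
  obtain ⟨k, rfl⟩ := IsQuasiCentral.exists_eq_garside_pow (a := a) (fun i => ⟨i,
    monoidToGroup_injective (by
      rw [map_mul, map_mul]
      exact Subgroup.mem_center_iff.mp hc _)⟩) hirr
  rw [map_pow] at ha
  rw [eq_inv_mul_of_mul_eq ha]
  refine mul_mem (inv_mem (pow_mem (pow_mem ?_ 2) n)) (pow_mem ?_ k) <;>
    exact Subgroup.mem_zpowers _

end

end CoxeterMatrix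

/-! ### Exclusion of affine diagrams -/

namespace CoxeterMatrix

variable {B : Type*} (M : CoxeterMatrix B)

theorem gram_nonpos {i j : B} (h : i ≠ j) : M.gram i j ≤ 0 := by
  rw [gram, Left.neg_nonpos_iff]
  by_cases h0 : M i j = 0
  · simp [h0]
  · have h2 : (2 : ℝ) ≤ M i j := by exact_mod_cast M.two_le_of_ne h h0
    refine Real.cos_nonneg_of_neg_pi_div_two_le_of_le ?_ ?_
    · have : 0 ≤ Real.pi / M i j := by positivity
      linarith [Real.pi_pos]
    · exact div_le_div_of_nonneg_left Real.pi_pos.le (by norm_num) h2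

theorem gram_le_neg_cos {i j : B} {k : ℕ} (hk : 1 ≤ k) (h : k ≤ M i j) :
    M.gram i j ≤ -Real.cos (Real.pi / k) := by
  have hk' : (1 : ℝ) ≤ k := by exact_mod_cast hk
  have h' : (k : ℝ) ≤ M i j := by exact_mod_cast h
  rw [gram, neg_le_neg_iff]
  refine Real.cos_le_cos_of_nonneg_of_le_pi (by positivity) ?_ ?_
  · exact div_le_self Real.pi_pos.le hk'
  · exact div_le_div_of_nonneg_left Real.pi_pos.le (by linarith) h'

theorem gram_le_of_three_le {i j : B} (h : 3 ≤ M i j) : M.gram i j ≤ -(1 / 2) := by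
  simpa using M.gram_le_neg_cos (by norm_num) h

theorem gram_le_of_four_le {i j : B} (h : 4 ≤ M i j) : M.gram i j ≤ -(√2 / 2) := by
  simpa using M.gram_le_neg_cos (by norm_num) h

theorem gram_le_of_six_le {i j : B} (h : 6 ≤ M i j) : M.gram i j ≤ -(√3 / 2) := by
  simpa using M.gram_le_neg_cos (by norm_num) h

section Form

variable [Fintype B] [DecidableEq B]

/-- The canonical bilinear form, with Gram matrix `M.gram`. -/
noncomputable def gramForm : LinearMap.BilinForm ℝ (B → ℝ) := Matrix.toBilin' (Matrix.of M.gram)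

theorem gramForm_apply (v w : B → ℝ) :
    M.gramForm v w = ∑ i, ∑ j, v i * w j * M.gram i j := by
  rw [gramForm, Matrix.toBilin'_apply]
  refine Finset.sum_congr rfl fun i _ => Finset.sum_congr rfl fun j _ => ?_
  rw [Matrix.of_apply]
  ring

theorem gramForm_comm (v w : B → ℝ) : M.gramForm v w = M.gramForm w v := by
  rw [gramForm_apply, gramForm_apply, Finset.sum_comm]
  refine Finset.sum_congr rfl fun i _ => Finset.sum_congr rfl fun j _ => ?_
  rw [M.gram_comm, mul_comm (v j)]

theorem gramForm_single (i j : B) :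
    M.gramForm (Pi.single i 1) (Pi.single j 1) = M.gram i j := by
  rw [gramForm, Matrix.toBilin'_single, Matrix.of_apply]

variable {M}

/-- The sum `e_{p k} + ⋯ + e_{p (l - 1)}` of the basis vectors along a stretch of a path. It has
norm at most `1`, and so stands in for a single vertex in the affine diagrams. -/
def chainSum {B : Type*} [DecidableEq B] (p : ℕ → B) (k l : ℕ) : B → ℝ :=
  ∑ t ∈ Finset.Ico k l, Pi.single (p t) 1

theorem chainSum_apply_eq_zero {B : Type*} [DecidableEq B] {p : ℕ → B} {k l : ℕ} {x : B}
    (hx : ∀ t, k ≤ t → t < l → x ≠ p t) : chainSum p k l x = 0 := by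
  rw [chainSum, Finset.sum_apply]
  refine Finset.sum_eq_zero fun t ht => ?_
  rw [Finset.mem_Ico] at ht
  exact Pi.single_eq_of_ne (hx t ht.1 ht.2) _

theorem gramForm_single_chainSum (p : ℕ → B) (k l : ℕ) (x : B) :
    M.gramForm (Pi.single x 1) (chainSum p k l) = ∑ t ∈ Finset.Ico k l, M.gram x (p t) := by
  rw [chainSum, map_sum]
  exact Finset.sum_congr rfl fun t _ => M.gramForm_single x (p t)

theorem gramForm_single_chainSum_le {p : ℕ → B} {k l : ℕ} {x : B}
    (hx : ∀ t, k ≤ t → t < l → x ≠ p t) {t : ℕ} (hkt : k ≤ t) (htl : t < l) :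
    M.gramForm (Pi.single x 1) (chainSum p k l) ≤ M.gram x (p t) := by
  rw [gramForm_single_chainSum]
  rw [← Finset.add_sum_erase _ _ (Finset.mem_Ico.mpr ⟨hkt, htl⟩)]
  refine add_le_of_nonpos_right (Finset.sum_nonpos fun u hu => ?_)
  rw [Finset.mem_erase, Finset.mem_Ico] at hu
  exact M.gram_nonpos (hx u hu.2.1 hu.2.2)

theorem gramForm_single_chainSum_le_add {p : ℕ → B} {k l : ℕ} {x : B}
    (hx : ∀ t, k ≤ t → t < l → x ≠ p t) {t t' : ℕ} (hkt : k ≤ t) (htl : t < t') (htl' : t' < l) :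
    M.gramForm (Pi.single x 1) (chainSum p k l) ≤ M.gram x (p t) + M.gram x (p t') := by
  have h : chainSum p k l = chainSum p k t' + chainSum p t' l := by
    rw [chainSum, chainSum, chainSum, Finset.sum_Ico_consecutive _ (by omega) (by omega)]
  rw [h, map_add]
  exact add_le_add (gramForm_single_chainSum_le (fun s h1 h2 => hx s h1 (by omega)) hkt htl)
    (gramForm_single_chainSum_le (fun s h1 h2 => hx s (by omega) h2) le_rfl htl')

theorem gramForm_chainSum_le {p : ℕ → B} {k l : ℕ} (hkl : k < l)
    (hinj : ∀ i j, k ≤ i → i < j → j < l → p i ≠ p j)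
    (hadj : ∀ t, k ≤ t → t + 1 < l → 3 ≤ M (p t) (p (t + 1))) :
    M.gramForm (chainSum p k l) (chainSum p k l) ≤ 1 := by
  induction l, hkl using Nat.le_induction with
  | base => simp [chainSum, gramForm_single, gram_self]
  | succ l hl ih =>
    rw [Nat.succ_le_iff] at hl
    have h : chainSum p k (l + 1) = chainSum p k l + Pi.single (p l) 1 := by
      rw [chainSum, Finset.sum_Ico_succ_top hl.le, chainSum]
    have h1 := ih (fun i j h1 h2 h3 => hinj i j h1 h2 (by omega))
      (fun t h1 h2 => hadj t h1 (by omega))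
    have h2 : M.gramForm (Pi.single (p l) 1) (chainSum p k l) ≤ _ :=
      gramForm_single_chainSum_le (t := l - 1)
      (fun t h1 h2 => (hinj t l h1 h2 (by omega)).symm) (by omega) (by omega)
    have h3 := hadj (l - 1) (by omega) (by omega)
    rw [Nat.sub_add_cancel (by omega), M.symmetric] at h3
    have h4 := M.gram_le_of_three_le h3
    rw [h]
    simp only [map_add, LinearMap.add_apply, gramForm_single, gram_self,
      M.gramForm_comm (chainSum p k l) (Pi.single _ _)]
    linarith

/-- Exclusion of cycles, with `y` the sum over all the vertices of the cycle except `x`. -/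
theorem not_cycle (hpos : ∀ v : B → ℝ, v ≠ 0 → 0 < M.gramForm v v) {y : B → ℝ} {x : B}
    (hy : M.gramForm y y ≤ 1) (hyx : y x = 0) (hx : M.gramForm (Pi.single x 1) y ≤ -1) :
    False := by
  have h := hpos (y + Pi.single x 1) (fun h => by simpa [hyx] using congrFun h x)
  simp only [map_add, LinearMap.add_apply, gramForm_single, gram_self,
    M.gramForm_comm y (Pi.single _ _)] at h
  linarith

/-- Exclusion of the affine diagrams of type `B`. -/
theorem not_branch (hpos : ∀ v : B → ℝ, v ≠ 0 → 0 < M.gramForm v v) {y : B → ℝ} {x z w : B}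
    (hy : M.gramForm y y ≤ 1) (hyx : y x = 0) (hxz : x ≠ z) (hxw : x ≠ w) (hzw : z ≠ w)
    (hx : M.gramForm (Pi.single x 1) y ≤ -(1 / 2)) (hz : M.gramForm (Pi.single z 1) y ≤ -(1 / 2))
    (hw : M.gramForm (Pi.single w 1) y ≤ -(√2 / 2)) : False := by
  have h := hpos ((2 : ℝ) • y + Pi.single x 1 + Pi.single z 1 + √2 • Pi.single w 1)
    (fun h => by simpa [hyx, hxz, hxw] using congrFun h x)
  have s2 : √2 * √2 = (2 : ℝ) := Real.mul_self_sqrt (by norm_num)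
  have p2 : (0 : ℝ) ≤ √2 := Real.sqrt_nonneg 2
  have := M.gram_nonpos hxz
  have e1 := mul_nonpos_of_nonneg_of_nonpos p2 (M.gram_nonpos hxw)
  have e2 := mul_nonpos_of_nonneg_of_nonpos p2 (M.gram_nonpos hzw)
  have e3 := mul_le_mul_of_nonneg_left hw p2
  simp only [map_add, map_smul, LinearMap.add_apply, LinearMap.smul_apply, smul_eq_mul,
    gramForm_single, gram_self, M.gramForm_comm y (Pi.single _ _), M.gram_comm z x,
    M.gram_comm w x, M.gram_comm w z] at h
  nlinarith

/-- Exclusion of the affine diagrams of type `C`. -/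
theorem not_two_heavy (hpos : ∀ v : B → ℝ, v ≠ 0 → 0 < M.gramForm v v) {y : B → ℝ} {z w : B}
    (hy : M.gramForm y y ≤ 1) (hyz : y z = 0) (hzw : z ≠ w)
    (hz : M.gramForm (Pi.single z 1) y ≤ -(√2 / 2))
    (hw : M.gramForm (Pi.single w 1) y ≤ -(√2 / 2)) : False := by
  have h := hpos (√2 • y + Pi.single z 1 + Pi.single w 1)
    (fun h => by simpa [hyz, hzw] using congrFun h z)
  have s2 : √2 * √2 = (2 : ℝ) := Real.mul_self_sqrt (by norm_num)
  have p2 : (0 : ℝ) ≤ √2 := Real.sqrt_nonneg 2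
  have := M.gram_nonpos hzw
  have e3 := mul_le_mul_of_nonneg_left hw p2
  have e4 := mul_le_mul_of_nonneg_left hz p2
  simp only [map_add, map_smul, LinearMap.add_apply, LinearMap.smul_apply, smul_eq_mul,
    gramForm_single, gram_self, M.gramForm_comm y (Pi.single _ _), M.gram_comm w z] at h
  nlinarith

/-- Exclusion of the affine diagram of type `G₂`. -/
theorem not_six (hpos : ∀ v : B → ℝ, v ≠ 0 → 0 < M.gramForm v v) {x y z : B}
    (hxy : x ≠ y) (hxz : x ≠ z) (h1 : 6 ≤ M x y) (h2 : 3 ≤ M y z) : False := by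
  have h := hpos (√3 • Pi.single x 1 + (2 : ℝ) • Pi.single y 1 + Pi.single z 1)
    (fun h => by simpa [hxy, hxz] using congrFun h x)
  have s2 : √3 * √3 = (3 : ℝ) := Real.mul_self_sqrt (by norm_num)
  have p2 : (0 : ℝ) ≤ √3 := Real.sqrt_nonneg 3
  have e1 := mul_nonpos_of_nonneg_of_nonpos p2 (M.gram_nonpos hxz)
  have e3 := mul_le_mul_of_nonneg_left (M.gram_le_of_six_le h1) p2
  have e4 := M.gram_le_of_three_le h2
  simp only [map_add, map_smul, LinearMap.add_apply, LinearMap.smul_apply, smul_eq_mul,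
    gramForm_single, gram_self, M.gram_comm y x, M.gram_comm z x, M.gram_comm z y] at h
  nlinarith

/-- Exclusion of the affine diagram of type `F₄`. -/
theorem not_inner_four (hpos : ∀ v : B → ℝ, v ≠ 0 → 0 < M.gramForm v v) {a b c d e : B}
    (hab : a ≠ b) (hac : a ≠ c) (had : a ≠ d) (hae : a ≠ e) (hbd : b ≠ d) (hbe : b ≠ e)
    (hce : c ≠ e) (h1 : 3 ≤ M a b) (h2 : 3 ≤ M b c) (h3 : 4 ≤ M c d) (h4 : 3 ≤ M d e) :
    False := by
  have h := hpos (Pi.single a 1 + (2 : ℝ) • Pi.single b 1 + (3 : ℝ) • Pi.single c 1 +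
    (2 * √2) • Pi.single d 1 + √2 • Pi.single e 1)
    (fun h => by simpa [hab, hac, had, hae] using congrFun h a)
  have s2 : √2 * √2 = (2 : ℝ) := Real.mul_self_sqrt (by norm_num)
  have p2 : (0 : ℝ) ≤ √2 := Real.sqrt_nonneg 2
  have e1 := M.gram_le_of_three_le h1
  have e2 := M.gram_le_of_three_le h2
  have e3 := mul_le_mul_of_nonneg_left (M.gram_le_of_four_le h3) p2
  have e4 := M.gram_le_of_three_le h4
  have f1 := M.gram_nonpos hac
  have f2 := mul_nonpos_of_nonneg_of_nonpos p2 (M.gram_nonpos had)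
  have f3 := mul_nonpos_of_nonneg_of_nonpos p2 (M.gram_nonpos hae)
  have f4 := mul_nonpos_of_nonneg_of_nonpos p2 (M.gram_nonpos hbd)
  have f5 := mul_nonpos_of_nonneg_of_nonpos p2 (M.gram_nonpos hbe)
  have f6 := mul_nonpos_of_nonneg_of_nonpos p2 (M.gram_nonpos hce)
  have f7 : √2 * √2 * M.gram d e = 2 * M.gram d e := by rw [s2]
  simp only [map_add, map_smul, LinearMap.add_apply, LinearMap.smul_apply, smul_eq_mul,
    gramForm_single, gram_self, M.gram_comm b a, M.gram_comm c a, M.gram_comm c b,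
    M.gram_comm d a, M.gram_comm d b, M.gram_comm d c, M.gram_comm e a, M.gram_comm e b,
    M.gram_comm e c, M.gram_comm e d] at h
  nlinarith

end Form

/-! ### Heavy paths -/

section Path

variable {M}

variable (M) in
/-- The first `n` values of `p` form a path in the Coxeter graph, one of whose
edges has an even label at least `4`. -/
structure IsHeavyPath (n : ℕ) (p : ℕ → B) : Prop where
  inj : ∀ i j, i < j → j < n → p i ≠ p j
  adj : ∀ i, i + 1 < n → 3 ≤ M (p i) (p (i + 1))
  heavy : ∃ l, l + 1 < n ∧ 4 ≤ M (p l) (p (l + 1)) ∧ Even (M (p l) (p (l + 1)))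

theorem IsHeavyPath.ne {n : ℕ} {p : ℕ → B} (h : M.IsHeavyPath n p) {i j : ℕ} (hi : i < n)
    (hj : j < n) (hij : i ≠ j) : p i ≠ p j := by
  rcases lt_or_gt_of_ne hij with hlt | hlt
  · exact h.inj i j hlt hj
  · exact (h.inj j i hlt hi).symm

theorem IsHeavyPath.reverse {n : ℕ} {p : ℕ → B} (h : M.IsHeavyPath n p) :
    M.IsHeavyPath n fun t => p (n - 1 - t) where
  inj i j hij hj := h.ne (by omega) (by omega) (by omega)
  adj i hi := by
    have := h.adj (n - 1 - (i + 1)) (by omega)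
    rwa [M.symmetric, show n - 1 - (i + 1) + 1 = n - 1 - i by omega] at this
  heavy := by
    obtain ⟨l, hl, h1, h2⟩ := h.heavy
    refine ⟨n - 1 - (l + 1), by omega, ?_⟩
    rw [M.symmetric, show n - 1 - (n - 1 - (l + 1)) = l + 1 by omega,
      show n - 1 - (n - 1 - (l + 1) + 1) = l by omega]
    exact ⟨h1, h2⟩

theorem IsHeavyPath.extend {n : ℕ} {p : ℕ → B} (h : M.IsHeavyPath n p) {x : B}
    (hx : ∀ t < n, p t ≠ x) (hadj : 3 ≤ M (p (n - 1)) x) :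
    M.IsHeavyPath (n + 1) fun t => if t < n then p t else x where
  inj i j hij hj := by
    by_cases hjn : j < n
    · simpa only [hij.trans hjn, hjn, if_true] using h.inj i j hij hjn
    · simpa only [show i < n by omega, hjn, if_true, if_false] using hx i (by omega)
  adj i hi := by
    by_cases hin : i + 1 < n
    · simpa only [show i < n by omega, hin, if_true] using h.adj i hin
    · obtain rfl : i = n - 1 := by omega
      have : n - 1 < n := by
        obtain ⟨l, hl, -⟩ := h.heavy
        omega
      simpa only [this, hin, if_true, if_false] using hadj
  heavy := by
    obtain ⟨l, hl, h1⟩ := h.heavy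
    refine ⟨l, by omega, ?_⟩
    simpa only [hl, show l < n by omega, if_true] using h1

theorem IsHeavyPath.le_card [Fintype B] {n : ℕ} {p : ℕ → B} (h : M.IsHeavyPath n p) :
    n ≤ Fintype.card B := by
  have : Function.Injective fun t : Fin n => p t := by
    intro i j hij
    by_contra hne
    exact h.ne i.2 j.2 (fun e => hne (Fin.ext e)) hij
  simpa using Fintype.card_le_of_injective _ this

theorem three_le_of_adj (hM : ∀ i j, M i j ≠ 0) {i j : B} (h : M.coxeterGraph.Adj i j) :
    3 ≤ M i j := by
  have h2 := M.two_le_of_ne h.1 (hM i j)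
  have := h.2
  omega

variable [Fintype B] [DecidableEq B] (hpos : ∀ v : B → ℝ, v ≠ 0 → 0 < M.gramForm v v)

include hpos in
/-- A longest path through an edge with even label exhausts the vertices, since a
further vertex would be attached to an inner vertex of the path. -/
theorem exists_heavyPath_surjOn (hM : ∀ i j, M i j ≠ 0) (hirr : M.IsIrreducible) {a b : B}
    (hab : 4 ≤ M a b) (heven : Even (M a b)) :
    ∃ n p, M.IsHeavyPath n p ∧ ∀ x, ∃ t < n, p t = x := by
  classical
  have hne : a ≠ b := by
    rintro rfl
    simp at hab
  have h0 : M.IsHeavyPath 2 fun t => if t = 0 then a else b := by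
    refine ⟨fun i j hij hj => ?_, fun i hi => ?_, 0, by omega, by simpa using ⟨hab, heven⟩⟩
    · obtain ⟨rfl, rfl⟩ : i = 0 ∧ j = 1 := by omega
      simpa using hne
    · obtain rfl : i = 0 := by omega
      simp only [if_true, zero_add, one_ne_zero, if_false]
      omega
  have hbd : ∃ n, (∃ p, M.IsHeavyPath n p) ∧ ∀ m, (∃ p, M.IsHeavyPath m p) → m ≤ n := by
    have hP : ∃ n, ∃ p, M.IsHeavyPath n p := ⟨2, _, h0⟩
    refine ⟨Nat.findGreatest (fun n => ∃ p, M.IsHeavyPath n p) (Fintype.card B), ?_, ?_⟩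
    · exact Nat.findGreatest_spec (P := fun n => ∃ p, M.IsHeavyPath n p) h0.le_card ⟨_, h0⟩
    · rintro m ⟨p, hp⟩
      exact Nat.le_findGreatest hp.le_card ⟨p, hp⟩
  obtain ⟨n, ⟨p, hp⟩, hmax⟩ := hbd
  refine ⟨n, p, hp, ?_⟩
  by_contra! hcon
  obtain ⟨x₀, hx₀⟩ := hcon
  obtain ⟨l, hl, hl4, -⟩ := hp.heavy
  obtain ⟨walk⟩ := hirr.preconnected (p 0) x₀
  obtain ⟨d, -, ⟨k, hk, hkd⟩, hd2⟩ := walk.exists_boundary_dart {y | ∃ t < n, p t = y}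
    ⟨0, by omega, rfl⟩ (by rintro ⟨t, ht, e⟩; exact hx₀ t ht e)
  have hadj := three_le_of_adj hM d.adj
  rw [← hkd] at hadj
  generalize d.snd = x at hadj hd2
  have hx : ∀ t < n, p t ≠ x := fun t ht e => hd2 ⟨t, ht, e⟩
  have hxk := M.gram_le_of_three_le (M.symmetric x _ ▸ hadj)
  by_cases hkn : k = n - 1
  · subst hkn
    have := hmax _ ⟨_, hp.extend hx hadj⟩
    omega
  by_cases hk0 : k = 0
  · subst hk0
    have := hmax _ ⟨_, hp.reverse.extend (x := x) (fun t ht => hx _ (by omega))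
      (by simpa using hadj)⟩
    omega
  by_cases hkl : k ≤ l
  · refine not_branch hpos (y := chainSum p k (l + 1)) (x := x) (z := p (k - 1)) (w := p (l + 1))
      (gramForm_chainSum_le (by omega) (fun i j _ h2 h3 => hp.inj i j h2 (by omega))
        (fun t _ h2 => hp.adj t (by omega))) (chainSum_apply_eq_zero fun t _ h2 =>
          (hx t (by omega)).symm) (hx _ (by omega)).symm (hx _ (by omega)).symm
      (hp.ne (by omega) (by omega) (by omega)) ?_ ?_ ?_
    · exact (gramForm_single_chainSum_le (fun t _ h2 => (hx t (by omega)).symm) le_rfl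
        (by omega)).trans hxk
    · refine (gramForm_single_chainSum_le (fun t h1 h2 => hp.ne (by omega) (by omega) (by omega))
        (t := k) le_rfl (by omega)).trans (M.gram_le_of_three_le ?_)
      have := hp.adj (k - 1) (by omega)
      rwa [Nat.sub_add_cancel (by omega)] at this
    · refine (gramForm_single_chainSum_le (fun t h1 h2 => hp.ne (by omega) (by omega) (by omega))
        (t := l) hkl (by omega)).trans (M.gram_le_of_four_le ?_)
      rwa [M.symmetric]
  · refine not_branch hpos (y := chainSum p (l + 1) (k + 1)) (x := x) (z := p (k + 1)) (w := p l)
      (gramForm_chainSum_le (by omega) (fun i j _ h2 h3 => hp.inj i j h2 (by omega))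
        (fun t _ h2 => hp.adj t (by omega))) (chainSum_apply_eq_zero fun t _ h2 =>
          (hx t (by omega)).symm) (hx _ (by omega)).symm (hx _ (by omega)).symm
      (hp.ne (by omega) (by omega) (by omega)) ?_ ?_ ?_
    · exact (gramForm_single_chainSum_le (fun t _ h2 => (hx t (by omega)).symm) (by omega)
        (by omega)).trans hxk
    · refine (gramForm_single_chainSum_le (fun t h1 h2 => hp.ne (by omega) (by omega) (by omega))
        (t := k) (by omega) (by omega)).trans (M.gram_le_of_three_le ?_)
      rw [M.symmetric]
      exact hp.adj k (by omega)
    · exact (gramForm_single_chainSum_le (fun t h1 h2 => hp.ne (by omega) (by omega) (by omega))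
        (t := l + 1) (by omega) (by omega)).trans (M.gram_le_of_four_le hl4)

variable {n : ℕ} {p : ℕ → B} (hp : M.IsHeavyPath n p)

include hpos hp

theorem IsHeavyPath.eq_two (hM : ∀ i j, M i j ≠ 0) {i j : ℕ} (hij : i + 1 < j) (hj : j < n) :
    M (p i) (p j) = 2 := by
  by_contra h2
  have h3 := three_le_of_adj hM (i := p i) (j := p j) ⟨hp.inj i j (by omega) hj, h2⟩
  have hout : ∀ t, i ≤ t → t < j → p j ≠ p t := fun t _ h2 => (hp.inj t j h2 hj).symm
  have h4 := hp.adj (j - 1) (by omega)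
  rw [Nat.sub_add_cancel (by omega), M.symmetric] at h4
  rw [M.symmetric] at h3
  have h5 := gramForm_single_chainSum_le_add (M := M) hout (t := i) (t' := j - 1) le_rfl (by omega)
    (by omega)
  have h6 := M.gram_le_of_three_le h3
  have h7 := M.gram_le_of_three_le h4
  refine not_cycle hpos (y := chainSum p i j) (x := p j)
      (gramForm_chainSum_le (by omega) (fun i j _ h2 h3 => hp.inj i j h2 (by omega))
        (fun t _ h2 => hp.adj t (by omega))) (chainSum_apply_eq_zero hout) (by linarith)

theorem IsHeavyPath.not_heavy {l l' : ℕ} (hl : l + 1 < n) (hl' : l' + 1 < n) (hne : l ≠ l')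
    (h4 : 4 ≤ M (p l) (p (l + 1))) : M (p l') (p (l' + 1)) = 3 := by
  have hlt : ∀ l l', l < l' → l' + 1 < n → 4 ≤ M (p l) (p (l + 1)) →
      4 ≤ M (p l') (p (l' + 1)) → False := by
    intro l l' hlt hl' h4 h4'
    refine not_two_heavy hpos (y := chainSum p (l + 1) (l' + 1)) (z := p l) (w := p (l' + 1))
      (gramForm_chainSum_le (by omega) (fun i j _ h2 h3 => hp.inj i j h2 (by omega))
        (fun t _ h2 => hp.adj t (by omega))) (chainSum_apply_eq_zero fun t h1 h2 =>
          hp.ne (by omega) (by omega) (by omega)) (hp.ne (by omega) (by omega) (by omega)) ?_ ?_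
    · exact (gramForm_single_chainSum_le (fun t h1 h2 => hp.ne (by omega) (by omega) (by omega))
        (t := l + 1) (by omega) (by omega)).trans (M.gram_le_of_four_le h4)
    · refine (gramForm_single_chainSum_le (fun t h1 h2 => hp.ne (by omega) (by omega) (by omega))
        (t := l') (by omega) (by omega)).trans (M.gram_le_of_four_le ?_)
      rwa [M.symmetric]
  have h3 := hp.adj l' hl'
  by_contra h
  rcases lt_or_gt_of_ne hne with hll | hll
  · exact hlt l l' hll hl' h4 (by omega)
  · exact hlt l' l hll hl (by omega) h4

theorem IsHeavyPath.eq_four {l : ℕ} (hl : l + 1 < n) (h4 : 4 ≤ M (p l) (p (l + 1)))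
    (heven : Even (M (p l) (p (l + 1)))) (hn : n ≠ 2) : M (p l) (p (l + 1)) = 4 := by
  have h6 : ¬ 6 ≤ M (p l) (p (l + 1)) := by
    intro h6
    by_cases h : l + 2 < n
    · exact not_six hpos (hp.inj l (l + 1) (by omega) (by omega))
        (hp.inj l (l + 2) (by omega) (by omega)) h6 (hp.adj (l + 1) h)
    · have := hp.adj (l - 1) (by omega)
      rw [Nat.sub_add_cancel (by omega), M.symmetric] at this
      rw [M.symmetric] at h6
      exact not_six hpos (hp.ne (i := l + 1) (j := l) (by omega) (by omega) (by omega))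
        (hp.ne (i := l + 1) (j := l - 1) (by omega) (by omega) (by omega)) h6 this
  obtain ⟨k, hk⟩ := heven
  omega

theorem IsHeavyPath.inner {l : ℕ} (h1 : 1 ≤ l) (hl : l + 2 < n)
    (h4 : 4 ≤ M (p l) (p (l + 1))) : l = 1 ∧ n = 4 := by
  by_contra hcon
  by_cases h : 2 ≤ l
  · obtain ⟨l, rfl⟩ := Nat.exists_eq_add_of_le' h
    exact not_inner_four hpos (a := p l) (b := p (l + 1)) (c := p (l + 2)) (d := p (l + 3))
      (e := p (l + 4)) (hp.inj _ _ (by omega) (by omega)) (hp.inj _ _ (by omega) (by omega))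
      (hp.inj _ _ (by omega) (by omega)) (hp.inj _ _ (by omega) (by omega))
      (hp.inj _ _ (by omega) (by omega)) (hp.inj _ _ (by omega) (by omega))
      (hp.inj _ _ (by omega) (by omega)) (hp.adj _ (by omega)) (hp.adj _ (by omega)) h4
      (hp.adj _ (by omega))
  · obtain rfl : l = 1 := by omega
    have hs : ∀ i, i + 1 < n → 3 ≤ M (p (i + 1)) (p i) := fun i hi => by
      rw [M.symmetric]
      exact hp.adj i hi
    rw [M.symmetric] at h4
    exact not_inner_four hpos (a := p 4) (b := p 3) (c := p 2) (d := p 1) (e := p 0)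
      (hp.ne (by omega) (by omega) (by omega)) (hp.ne (by omega) (by omega) (by omega))
      (hp.ne (by omega) (by omega) (by omega)) (hp.ne (by omega) (by omega) (by omega))
      (hp.ne (by omega) (by omega) (by omega)) (hp.ne (by omega) (by omega) (by omega))
      (hp.ne (by omega) (by omega) (by omega)) (hs _ (by omega)) (hs _ (by omega)) h4
      (hs _ (by omega))

end Path

/-! ### The types with an even label -/

section Types

variable {M}

theorem isOfType_of_equiv {C : Type*} {N : CoxeterMatrix C} (f : C ≃ B)
    (h : ∀ s t, M (f s) (f t) = N s t) : M.IsOfType N :=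
  ⟨f.symm, CoxeterMatrix.ext (funext fun s => funext fun t => h s t)⟩

theorem isOfType_of_lt {n : ℕ} {N : CoxeterMatrix (Fin n)} {p : ℕ → B}
    (hinj : ∀ i j, i < j → j < n → p i ≠ p j) (hsurj : ∀ x, ∃ t < n, p t = x)
    (h : ∀ s t : Fin n, s < t → M (p s) (p t) = N s t) : M.IsOfType N := by
  have hbij : Function.Bijective fun t : Fin n => p t := by
    constructor
    · intro i j hij
      by_contra hne
      rcases lt_or_gt_of_ne hne with hlt | hlt
      · exact hinj i j hlt j.2 hij
      · exact hinj j i hlt i.2 hij.symm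
    · intro x
      obtain ⟨t, ht, rfl⟩ := hsurj x
      exact ⟨⟨t, ht⟩, rfl⟩
  refine isOfType_of_equiv (Equiv.ofBijective _ hbij) fun s t => ?_
  rw [Equiv.ofBijective_apply, Equiv.ofBijective_apply]
  rcases lt_trichotomy s t with hlt | rfl | hlt
  · exact h s t hlt
  · rw [M.diagonal, N.diagonal]
  · rw [M.symmetric, N.symmetric]
    exact h t s hlt

variable [Fintype B] [DecidableEq B] (hpos : ∀ v : B → ℝ, v ≠ 0 → 0 < M.gramForm v v)

include hpos

theorem IsHeavyPath.isOfType_B (hM : ∀ i j, M i j ≠ 0) {n : ℕ} {p : ℕ → B}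
    (hp : M.IsHeavyPath n p) (hsurj : ∀ x, ∃ t < n, p t = x) {l : ℕ} (hl : l + 2 = n)
    (h4 : M (p l) (p (l + 1)) = 4) : M.IsOfType (CoxeterMatrix.B n) := by
  refine isOfType_of_lt hp.inj hsurj fun s t hst => ?_
  have hst' : (s : ℕ) < t := hst
  have ht := t.2
  simp only [CoxeterMatrix.B, Matrix.of_apply, hst.ne, if_false]
  by_cases h1 : (s : ℕ) + 1 = t
  · by_cases h2 : (s : ℕ) = l
    · rw [if_pos (by omega), ← h1, h2, h4]
    · rw [if_neg (by omega), if_pos (by omega), ← h1]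
      exact hp.not_heavy hpos (l := l) (by omega) (by omega) (Ne.symm h2) h4.ge
  · rw [if_neg (by omega), if_neg (by omega), hp.eq_two hpos hM (by omega) ht]

theorem IsHeavyPath.isOfType_F₄ (hM : ∀ i j, M i j ≠ 0) {p : ℕ → B}
    (hp : M.IsHeavyPath 4 p) (hsurj : ∀ x, ∃ t < 4, p t = x)
    (h4 : M (p 1) (p 2) = 4) : M.IsOfType CoxeterMatrix.F₄ := by
  refine isOfType_of_lt hp.inj hsurj fun s t hst => ?_
  have h01 := hp.not_heavy hpos (l := 1) (l' := 0) (by omega) (by omega) (by omega) h4.ge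
  have h23 := hp.not_heavy hpos (l := 1) (l' := 2) (by omega) (by omega) (by omega) h4.ge
  have h02 := hp.eq_two hpos hM (i := 0) (j := 2) (by omega) (by omega)
  have h03 := hp.eq_two hpos hM (i := 0) (j := 3) (by omega) (by omega)
  have h13 := hp.eq_two hpos hM (i := 1) (j := 3) (by omega) (by omega)
  fin_cases s <;> fin_cases t <;> first | (exact absurd hst (by decide)) | assumption

/-- A connected Coxeter matrix with positive definite Gram form and an edge with even label is
of type `I₂(2m)`, `Bₙ` or `F₄`. -/
theorem isOfType_of_even (hM : ∀ i j, M i j ≠ 0) (hirr : M.IsIrreducible) {a b : B}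
    (hab : M.coxeterGraph.Adj a b) (heven : Even (M a b)) :
    (∃ m : ℕ, 2 ≤ m ∧ M.IsOfType (CoxeterMatrix.I (2 * m - 2))) ∨
      (∃ n : ℕ, 2 ≤ n ∧ M.IsOfType (CoxeterMatrix.B n)) ∨ M.IsOfType CoxeterMatrix.F₄ := by
  have h3 := three_le_of_adj hM hab
  obtain ⟨n, p, hp, hsurj⟩ := exists_heavyPath_surjOn hpos hM hirr
    (show 4 ≤ M a b by obtain ⟨k, hk⟩ := heven; omega) heven
  obtain ⟨l, hl, h4, heven⟩ := hp.heavy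
  by_cases hn : n = 2
  · subst hn
    obtain rfl : l = 0 := by omega
    obtain ⟨k, hk⟩ := heven
    refine Or.inl ⟨k, by omega, isOfType_of_lt hp.inj hsurj fun s t hst => ?_⟩
    have hst' : (s : ℕ) < t := hst
    have ht := t.2
    simp only [CoxeterMatrix.I, Matrix.of_apply, hst.ne, if_false]
    rw [show (s : ℕ) = 0 by omega, show (t : ℕ) = 0 + 1 by omega, hk]
    omega
  have h4' := hp.eq_four hpos hl h4 heven hn
  by_cases hl2 : l + 2 = n
  · exact Or.inr (Or.inl ⟨n, by omega, hp.isOfType_B hpos hM hsurj hl2 h4'⟩)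
  by_cases hl0 : l = 0
  · subst hl0
    refine Or.inr (Or.inl ⟨n, by omega, hp.reverse.isOfType_B hpos hM ?_
      (l := n - 2) (by omega) ?_⟩)
    · intro x
      obtain ⟨t, ht, rfl⟩ := hsurj x
      exact ⟨n - 1 - t, by omega, by rw [show n - 1 - (n - 1 - t) = t by omega]⟩
    · rw [M.symmetric, show n - 1 - (n - 2 + 1) = 0 by omega, show n - 1 - (n - 2) = 0 + 1 by omega,
        h4']
  obtain ⟨rfl, rfl⟩ := hp.inner hpos (l := l) (by omega) (by omega) h4
  exact Or.inr (Or.inr (hp.isOfType_F₄ hpos hM hsurj h4'))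

end Types

end CoxeterMatrix

/-! ### The abelianization of the Artin group -/

theorem altProd_two_mul {G : Type*} [Monoid G] (a b : G) (k : ℕ) :
    altProd a b (2 * k) = (a * b) ^ k := by
  induction k with
  | zero => rw [mul_zero, altProd, pow_zero]
  | succ k ih => rw [mul_add, mul_one, altProd, altProd, ih, pow_succ', mul_assoc]

theorem altProd_two_mul_add_one {G : Type*} [Monoid G] (a b : G) (k : ℕ) :
    altProd a b (2 * k + 1) = (a * b) ^ k * a := by
  rw [altProd, altProd_two_mul, mul_pow_mul]

namespace CoxeterMatrix

variable {B : Type*} {M : CoxeterMatrix B}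

/-- The universal property of the Artin group. -/
def groupLift {G : Type*} [Group G] (f : B → G)
    (hf : ∀ i j, i ≠ j → altProd (f i) (f j) (M i j) = altProd (f j) (f i) (M i j)) :
    M.ArtinGroup →* G :=
  PresentedGroup.toGroup (f := f) (by
    rintro r ⟨i, j, hij, -, rfl⟩
    rw [map_mul, map_inv, map_altProd, map_altProd, FreeGroup.lift_apply_of,
      FreeGroup.lift_apply_of, hf i j hij, mul_inv_cancel])

theorem groupLift_of {G : Type*} [Group G] (f : B → G) (hf) (i : B) :
    groupLift (M := M) f hf (PresentedGroup.of i) = f i :=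
  PresentedGroup.toGroup.of _

theorem artinLength_of (i : B) :
    M.artinLength (PresentedGroup.of i) = Multiplicative.ofAdd 1 :=
  PresentedGroup.toGroup.of _

section Abelianization

/-- If the abelianization is infinite cyclic, all homomorphisms to `ℤ` are proportional. -/
theorem exists_factor {G : Type*} [Group G]
    (h : Nonempty (Abelianization G ≃* Multiplicative ℤ)) :
    ∃ n : G → ℤ, ∀ f : G →* Multiplicative ℤ, ∃ c : ℤ, ∀ x, Multiplicative.toAdd (f x) = n x * c := by
  obtain ⟨ψ⟩ := h
  refine ⟨fun x => Multiplicative.toAdd (ψ (Abelianization.of x)), fun f =>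
    ⟨Multiplicative.toAdd (Abelianization.lift f (ψ.symm (Multiplicative.ofAdd 1))), fun x => ?_⟩⟩
  have h1 : ψ (Abelianization.of x) =
      Multiplicative.ofAdd 1 ^ Multiplicative.toAdd (ψ (Abelianization.of x)) := by
    rw [← ofAdd_zsmul, smul_eq_mul, mul_one, ofAdd_toAdd]
  have h2 : Abelianization.of x = ψ.symm (Multiplicative.ofAdd 1) ^
      Multiplicative.toAdd (ψ (Abelianization.of x)) := by
    rw [← map_zpow, ← h1, MulEquiv.symm_apply_apply]
  have h3 := congrArg (Abelianization.lift f) h2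
  rw [Abelianization.lift_apply_of, map_zpow] at h3
  rw [h3, toAdd_zpow, smul_eq_mul]

/-- Vertices in two classes that are joined by even labels only give a homomorphism to `ℤ` that is
not proportional to the length. -/
theorem not_nonempty_abelianization_of_coloring (c : B → Prop) {a b : B} (ha : c a) (hb : ¬ c b)
    (hc : ∀ i j, c i → ¬ c j → Even (M i j)) :
    ¬ Nonempty (Abelianization M.ArtinGroup ≃* Multiplicative ℤ) := by
  classical
  intro h
  obtain ⟨n, hn⟩ := exists_factor h
  obtain ⟨e, he⟩ := hn M.artinLength
  have hcomm : ∀ (x y : Multiplicative ℤ) (m : ℕ), Even m → altProd x y m = altProd y x m := by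
    rintro x y m ⟨k, rfl⟩
    rw [← two_mul, altProd_two_mul, altProd_two_mul, mul_comm x y]
  obtain ⟨d, hd⟩ := hn (groupLift
    (fun i => if c i then Multiplicative.ofAdd (1 : ℤ) else 1) (by
      intro i j _
      by_cases hi : c i <;> by_cases hj : c j
      · simp [hi, hj]
      · exact hcomm _ _ _ (hc i j hi hj)
      · exact hcomm _ _ _ (M.symmetric i j ▸ hc j i hj hi)
      · simp [hi, hj]))
  have e1 := he (PresentedGroup.of a)
  have e2 := he (PresentedGroup.of b)
  have d1 := hd (PresentedGroup.of a)
  have d2 := hd (PresentedGroup.of b)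
  rw [groupLift_of, if_pos ha, toAdd_ofAdd] at d1
  rw [groupLift_of, if_neg hb, toAdd_one] at d2
  rw [artinLength_of, toAdd_ofAdd] at e1 e2
  rcases mul_eq_zero.mp d2.symm with h | h
  · rw [h, zero_mul] at e2
    omega
  · rw [h, mul_zero] at d1
    omega

/-- Generators joined by an edge with odd label agree in the abelianization. -/
theorem nonempty_abelianization_of_odd [Nonempty B] (hirr : M.IsIrreducible)
    (hodd : ∀ i j, M.coxeterGraph.Adj i j → Odd (M i j)) :
    Nonempty (Abelianization M.ArtinGroup ≃* Multiplicative ℤ) := by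
  let g : B → Abelianization M.ArtinGroup := fun i => Abelianization.of (PresentedGroup.of i)
  have hadj : ∀ i j, M.coxeterGraph.Adj i j → g i = g j := by
    intro i j hij
    have h := congrArg Abelianization.of (artin_relation (M := M) i j hij.1)
    obtain ⟨k, hk⟩ := hodd i j hij
    rw [map_altProd, map_altProd, hk, altProd_two_mul_add_one, altProd_two_mul_add_one,
      mul_comm (Abelianization.of (PresentedGroup.of j))] at h
    exact mul_left_cancel h
  have hconst : ∀ i j, g i = g j := by
    intro i j
    obtain ⟨w⟩ := hirr.preconnected i j
    induction w with
    | nil => rfl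
    | cons h _ ih => exact (hadj _ _ h).trans ih
  obtain ⟨b⟩ := ‹Nonempty B›
  refine ⟨MonoidHom.toMulEquiv (Abelianization.lift M.artinLength) (zpowersHom _ (g b)) ?_ ?_⟩
  · refine Abelianization.hom_ext _ _ (PresentedGroup.ext fun i => ?_)
    simp only [MonoidHom.comp_apply, Abelianization.lift_apply_of, artinLength_of, MonoidHom.id_apply,
      zpowersHom_apply, toAdd_ofAdd, zpow_one]
    exact hconst b i
  · refine MonoidHom.ext_mint ?_
    simp only [MonoidHom.comp_apply, zpowersHom_apply, toAdd_ofAdd, zpow_one, MonoidHom.id_apply]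
    exact (Abelianization.lift_apply_of _ _).trans (artinLength_of b)

theorem not_nonempty_abelianization_of_isOfType {C : Type*} {N : CoxeterMatrix C}
    (h : M.IsOfType N) (c : C → Prop) {a b : C} (ha : c a) (hb : ¬ c b)
    (hc : ∀ i j, c i → ¬ c j → Even (N i j)) :
    ¬ Nonempty (Abelianization M.ArtinGroup ≃* Multiplicative ℤ) := by
  obtain ⟨e, rfl⟩ := h
  refine not_nonempty_abelianization_of_coloring (M := M) (fun i => c (e i)) (a := e.symm a)
    (b := e.symm b) (by simpa using ha) (by simpa using hb) fun i j hi hj => ?_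
  simpa [reindex_apply] using hc (e i) (e j) hi hj

theorem exists_adj [Nontrivial B] (hirr : M.IsIrreducible) : ∃ i j, M.coxeterGraph.Adj i j := by
  obtain ⟨i, j, hij⟩ := exists_pair_ne B
  obtain ⟨w⟩ := hirr.preconnected i j
  obtain ⟨d, -⟩ := w.exists_boundary_dart {i} rfl (by simpa using hij.symm)
  exact ⟨_, _, d.adj⟩

theorem exists_gramForm_pos [Fintype B] [DecidableEq B] (hirr : M.IsIrreducible)
    [Finite M.Group] {v : B → ℝ} (hv : v ≠ 0) : 0 < M.gramForm v v := by
  rw [gramForm_apply]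
  refine M.toCoxeterSystem.exists_gram_pos (fun c hc i j => ?_) hv
  obtain ⟨w⟩ := hirr.preconnected i j
  induction w with
  | nil => rfl
  | cons h _ ih =>
    refine (hc _ _ ?_).trans ih
    have := M.gram_le_of_three_le (three_le_of_adj M.toCoxeterSystem.matrix_ne_zero h)
    linarith

theorem even_F₄ (i j : Fin 4) (hi : i < 2) (hj : ¬ j < 2) : Even (CoxeterMatrix.F₄ i j) := by
  fin_cases i <;> fin_cases j <;>
    first
    | exact absurd hi (by decide)
    | exact absurd (by decide) hj
    | exact ⟨1, rfl⟩
    | exact ⟨2, rfl⟩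

/-- The abelianization is infinite cyclic exactly when there is no edge with even label. -/
theorem nonempty_abelianization_iff [Finite B] [Nontrivial B] [Finite M.Group]
    (hirr : M.IsIrreducible) :
    Nonempty (Abelianization M.ArtinGroup ≃* Multiplicative ℤ) ↔
      ¬ ((∃ m : ℕ, 2 ≤ m ∧ M.IsOfType (CoxeterMatrix.I (2 * m - 2))) ∨
        (∃ n : ℕ, 2 ≤ n ∧ M.IsOfType (CoxeterMatrix.B n)) ∨
        M.IsOfType CoxeterMatrix.F₄) := by
  classical
  have := Fintype.ofFinite B
  constructor
  · rintro h (⟨m, hm, hI⟩ | ⟨n, hn, hB⟩ | hF)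
    · refine not_nonempty_abelianization_of_isOfType hI (fun i => i = 0) (a := 0) (b := 1) rfl
        (by decide) (fun i j hi hj => ?_) h
      simp only [CoxeterMatrix.I, Matrix.of_apply, show i ≠ j from fun e => hj (e ▸ hi), if_false]
      exact ⟨m, by omega⟩
    · refine not_nonempty_abelianization_of_isOfType hB (fun i => (i : ℕ) = n - 1)
        (a := ⟨n - 1, by omega⟩) (b := ⟨0, by omega⟩) rfl
        (by simp only; omega) (fun i j hi hj => ?_) h
      have hij : i ≠ j := fun e => hj (e ▸ hi)
      have := i.2
      have := j.2
      simp only [CoxeterMatrix.B, Matrix.of_apply, hij, if_false]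
      split_ifs
      · exact ⟨2, rfl⟩
      · omega
      · exact ⟨1, rfl⟩
    · refine not_nonempty_abelianization_of_isOfType hF (fun i => i < 2) (a := 0) (b := 3)
        (by decide) (by decide) even_F₄ h
  · intro h
    refine nonempty_abelianization_of_odd hirr fun i j hij => ?_
    rw [← Nat.not_even_iff_odd]
    exact fun heven => h (isOfType_of_even (fun v hv => exists_gramForm_pos hirr hv)
      M.toCoxeterSystem.matrix_ne_zero hirr hij heven)

end Abelianization

end CoxeterMatrix

/-! ### Length and the centre -/

namespace CoxeterMatrix

open ArtinMonoid

variable {B : Type*} {M : CoxeterMatrix B}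

theorem three_le_degree_garside [Finite B] [Nontrivial B] [Finite M.Group]
    (hirr : M.IsIrreducible) : 3 ≤ degree (garside M) := by
  obtain ⟨i, j, hij⟩ := exists_adj hirr
  exact (three_le_of_adj M.toCoxeterSystem.matrix_ne_zero hij).trans
    (le_degree_garside i j hij.1)

theorem artinLength_garsideElement_zpow [Finite B] [Finite M.Group] (k : ℤ) :
    Multiplicative.toAdd (M.artinLength (garsideElement M ^ k)) = k * degree (garside M) := by
  rw [map_zpow, garsideElement, artinLength_monoidToGroup, toAdd_zpow, toAdd_ofAdd, smul_eq_mul]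

theorem exists_zpowers_eq_center [Finite B] [Finite M.Group] (hirr : M.IsIrreducible) :
    ∃ ζ : M.ArtinGroup, Subgroup.zpowers ζ = Subgroup.center M.ArtinGroup := by
  have h := center_le_zpowers hirr
  have : IsCyclic (Subgroup.center M.ArtinGroup) :=
    isCyclic_of_injective (Subgroup.inclusion h) (Subgroup.inclusion_injective h)
  exact (Subgroup.isCyclic_iff_exists_zpowers_eq_top _).mp this

/-- A generator of the centre has length at least `3` in absolute value. -/
theorem three_le_abs_artinLength [Finite B] [Nontrivial B] [Finite M.Group]
    (hirr : M.IsIrreducible) {ζ : M.ArtinGroup}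
    (hζ : Subgroup.zpowers ζ = Subgroup.center M.ArtinGroup) :
    3 ≤ |Multiplicative.toAdd (M.artinLength ζ)| := by
  have h3 := three_le_degree_garside hirr
  obtain ⟨k, rfl⟩ := Subgroup.mem_zpowers_iff.mp
    (center_le_zpowers hirr (hζ ▸ Subgroup.mem_zpowers ζ))
  have hk : k ≠ 0 := by
    rintro rfl
    have hsq := garsideElement_sq_mem_center (M := M)
    rw [← hζ, zpow_zero, Subgroup.zpowers_one_eq_bot, Subgroup.mem_bot] at hsq
    have := artinLength_garsideElement_zpow (M := M) 2
    rw [zpow_ofNat, hsq, map_one, toAdd_one] at this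
    omega
  rw [artinLength_garsideElement_zpow, abs_mul, Nat.abs_cast]
  have := Int.one_le_abs hk
  nlinarith

variable {ζ : M.ArtinGroup} (hζ : Subgroup.zpowers ζ = Subgroup.center M.ArtinGroup)

include hζ in
theorem eq_one_of_mem_center (hd : 3 ≤ |Multiplicative.toAdd (M.artinLength ζ)|)
    {z : M.ArtinGroup} (hz : z ∈ Subgroup.center M.ArtinGroup)
    (h : |Multiplicative.toAdd (M.artinLength z)| < 3) : z = 1 := by
  rw [← hζ] at hz
  obtain ⟨k, rfl⟩ := Subgroup.mem_zpowers_iff.mp hz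
  rw [map_zpow, toAdd_zpow, smul_eq_mul, abs_mul] at h
  have hk : k = 0 := by
    by_contra hk
    have := Int.one_le_abs hk
    nlinarith
  rw [hk, zpow_zero]

/-! ### Lifting automorphisms from the quotient by the centre -/

include hζ in
/-- An endomorphism that preserves or reverses the length and is trivial modulo the
centre is trivial. -/
theorem eq_id_of_mk_eq (hd : 3 ≤ |Multiplicative.toAdd (M.artinLength ζ)|)
    (φ : M.ArtinGroup →* M.ArtinGroup)
    (hφ : (∀ x, M.artinLength (φ x) = M.artinLength x) ∨
      ∀ x, M.artinLength (φ x) = (M.artinLength x)⁻¹)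
    (h : ∀ x, (φ x : M.ArtinGroup ⧸ Subgroup.center M.ArtinGroup) = x) : φ = MonoidHom.id _ := by
  refine PresentedGroup.ext fun i => ?_
  have hz := QuotientGroup.eq.mp (h (PresentedGroup.of i)).symm
  refine (inv_mul_eq_one.mp (eq_one_of_mem_center hζ hd hz ?_)).symm
  rw [map_mul, map_inv, toAdd_mul, toAdd_inv]
  rcases hφ with hφ | hφ <;> rw [hφ, artinLength_of] <;> simp

/-- An automorphism of the quotient by the centre that preserves or reverses the length modulo
the length of the generator lifts to an endomorphism that preserves or reverses the length. -/
theorem exists_lift_of_mem_autStar (hd : 3 ≤ |Multiplicative.toAdd (M.artinLength ζ)|)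
    (β : MulAut (M.ArtinGroup ⧸ Subgroup.center M.ArtinGroup))
    (hβ : β ∈ autStar (M.artinLengthModCenter ζ hζ)) :
    ∃ φ : M.ArtinGroup →* M.ArtinGroup,
      ((∀ x, M.artinLength (φ x) = M.artinLength x) ∨
        ∀ x, M.artinLength (φ x) = (M.artinLength x)⁻¹) ∧
      ∀ x : M.ArtinGroup, (φ x : M.ArtinGroup ⧸ Subgroup.center M.ArtinGroup) = β x := by
  obtain ⟨ε, hε, hβ⟩ : ∃ ε : ℤ, (ε = 1 ∨ ε = -1) ∧ ∀ x, M.artinLengthModCenter ζ hζ (β x) =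
      M.artinLengthModCenter ζ hζ x ^ ε := by
    rcases hβ with hβ | hβ
    · exact ⟨1, Or.inl rfl, fun x => by rw [hβ, zpow_one]⟩
    · exact ⟨-1, Or.inr rfl, fun x => by rw [hβ, zpow_neg_one]⟩
  have hζc : ζ ∈ Subgroup.center M.ArtinGroup := hζ ▸ Subgroup.mem_zpowers ζ
  -- lifts of the images of the generators, corrected by a central element to have length `ε`
  have ht : ∀ i : B, ∃ t : M.ArtinGroup,
      (t : M.ArtinGroup ⧸ Subgroup.center M.ArtinGroup) =
        β (PresentedGroup.of i : M.ArtinGroup) ∧ M.artinLength t = Multiplicative.ofAdd ε := by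
    intro i
    obtain ⟨t, ht⟩ := QuotientGroup.mk_surjective (β (PresentedGroup.of i : M.ArtinGroup))
    have h := hβ (PresentedGroup.of i : M.ArtinGroup)
    rw [← ht, artinLengthModCenter_mk, artinLengthModCenter_mk, artinLength_of, ← ofAdd_zsmul,
      Multiplicative.ofAdd.injective.eq_iff, toAdd_ofAdd, Int.cast_one, zsmul_one,
      ← sub_eq_zero, ← Int.cast_sub, ZMod.intCast_zmod_eq_zero_iff_dvd, Int.natAbs_dvd] at h
    obtain ⟨k, hk⟩ := h
    refine ⟨t * ζ ^ (-k), ?_, ?_⟩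
    · rw [← ht, QuotientGroup.eq, mul_inv_rev, inv_mul_cancel_right]
      exact inv_mem (zpow_mem hζc _)
    · apply Multiplicative.toAdd.injective
      rw [map_mul, map_zpow, toAdd_mul, toAdd_zpow, toAdd_ofAdd, smul_eq_mul]
      linear_combination hk
  choose t ht hlt using ht
  have hrel : ∀ i j, i ≠ j → altProd (t i) (t j) (M i j) = altProd (t j) (t i) (M i j) := by
    intro i j hij
    refine (inv_mul_eq_one.mp (eq_one_of_mem_center hζ hd (QuotientGroup.eq.mp ?_) ?_))
    · have h : ∀ i j, QuotientGroup.mk' (Subgroup.center M.ArtinGroup)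
          (altProd (t i) (t j) (M.M i j)) =
            (β : _ →* _).comp (QuotientGroup.mk' (Subgroup.center M.ArtinGroup))
            (altProd (PresentedGroup.of i : M.ArtinGroup) (PresentedGroup.of j) (M.M i j)) := by
        intro i j
        rw [map_altProd, map_altProd]
        exact congrArg₂ (fun x y => altProd x y (M i j)) (ht i) (ht j)
      have h' := h j i
      rw [M.symmetric j i] at h'
      exact (h i j).trans ((congrArg _ (artin_relation i j hij)).trans h'.symm)
    · rw [map_mul, map_inv, map_altProd, map_altProd, hlt, hlt]
      simp
  refine ⟨groupLift t hrel, ?_, ?_⟩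
  · have h : ∀ x, M.artinLength (groupLift t hrel x) = M.artinLength x ^ ε := by
      intro x
      have : M.artinLength.comp (groupLift t hrel) = (zpowGroupHom ε).comp M.artinLength := by
        refine PresentedGroup.ext fun i => ?_
        rw [MonoidHom.comp_apply, MonoidHom.comp_apply, groupLift_of, hlt, artinLength_of,
          zpowGroupHom_apply, ← ofAdd_zsmul, smul_eq_mul, mul_one]
      exact DFunLike.congr_fun this x
    rcases hε with rfl | rfl
    · exact Or.inl fun x => by rw [h, zpow_one]
    · exact Or.inr fun x => by rw [h, zpow_neg_one]
  · have : (QuotientGroup.mk' (Subgroup.center M.ArtinGroup)).comp (groupLift t hrel) =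
        (β : _ →* _).comp (QuotientGroup.mk' (Subgroup.center M.ArtinGroup)) := by
      refine PresentedGroup.ext fun i => ?_
      rw [MonoidHom.comp_apply, MonoidHom.comp_apply, groupLift_of]
      exact ht i
    exact fun x => DFunLike.congr_fun this x

theorem autStarMap_coe (α : autStar M.artinLength) :
    (M.autStarMap ζ hζ α : MulAut (M.ArtinGroup ⧸ Subgroup.center M.ArtinGroup)) =
      autModCenter M.ArtinGroup α := rfl

include hζ in
theorem eq_one_of_autModCenter_eq_one (hd : 3 ≤ |Multiplicative.toAdd (M.artinLength ζ)|)
    {α : MulAut M.ArtinGroup} (hα : α ∈ autStar M.artinLength)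
    (h : ∀ x, (α x : M.ArtinGroup ⧸ Subgroup.center M.ArtinGroup) = x) : α = 1 :=
  MulEquiv.ext fun x => DFunLike.congr_fun (eq_id_of_mk_eq hζ hd α.toMonoidHom hα h) x

theorem autStarMap_bijective (hd : 3 ≤ |Multiplicative.toAdd (M.artinLength ζ)|) :
    Function.Bijective (M.autStarMap ζ hζ) := by
  constructor
  · rw [injective_iff_map_eq_one]
    intro α hα
    refine Subtype.ext (eq_one_of_autModCenter_eq_one hζ hd α.2 fun x => ?_)
    have h := congrArg Subtype.val hα
    rw [autStarMap_coe] at h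
    exact DFunLike.congr_fun h (x : M.ArtinGroup ⧸ Subgroup.center M.ArtinGroup)
  · rintro ⟨β, hβ⟩
    obtain ⟨φ, hφ, hφβ⟩ := exists_lift_of_mem_autStar hζ hd β hβ
    obtain ⟨ψ, hψ, hψβ⟩ := exists_lift_of_mem_autStar hζ hd β⁻¹ (inv_mem hβ)
    have hlen : ∀ φ ψ : M.ArtinGroup →* M.ArtinGroup,
        ((∀ x, M.artinLength (φ x) = M.artinLength x) ∨
          ∀ x, M.artinLength (φ x) = (M.artinLength x)⁻¹) →
        ((∀ x, M.artinLength (ψ x) = M.artinLength x) ∨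
          ∀ x, M.artinLength (ψ x) = (M.artinLength x)⁻¹) →
        ((∀ x, M.artinLength (φ.comp ψ x) = M.artinLength x) ∨
          ∀ x, M.artinLength (φ.comp ψ x) = (M.artinLength x)⁻¹) := by
      rintro φ ψ (h1 | h1) (h2 | h2) <;> simp [h1, h2]
    have h1 : φ.comp ψ = MonoidHom.id _ := eq_id_of_mk_eq hζ hd _ (hlen φ ψ hφ hψ) fun x => by
      rw [MonoidHom.comp_apply, hφβ, hψβ, MulAut.apply_inv_self]
    have h2 : ψ.comp φ = MonoidHom.id _ := eq_id_of_mk_eq hζ hd _ (hlen ψ φ hψ hφ) fun x => by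
      rw [MonoidHom.comp_apply, hψβ, hφβ, MulAut.inv_apply_self]
    refine ⟨⟨MonoidHom.toMulEquiv φ ψ h2 h1, hφ⟩, Subtype.ext (MulEquiv.ext fun x => ?_)⟩
    induction x using QuotientGroup.induction_on with
    | H x => exact hφβ x

theorem autStar_artinLength_eq_top [Nonempty B]
    (h : Nonempty (Abelianization M.ArtinGroup ≃* Multiplicative ℤ)) :
    autStar M.artinLength = ⊤ := by
  rw [eq_top_iff]
  intro α _
  obtain ⟨n, hn⟩ := exists_factor h
  obtain ⟨c, hc⟩ := hn M.artinLength
  obtain ⟨e, he⟩ := hn (M.artinLength.comp (α : _ →* _))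
  obtain ⟨b⟩ := ‹Nonempty B›
  have h1 := hc (PresentedGroup.of b)
  have h2 := he (α⁻¹ (PresentedGroup.of b))
  change Multiplicative.toAdd (M.artinLength (α (α⁻¹ _))) = _ at h2
  rw [MulAut.apply_inv_self] at h2
  rw [artinLength_of, toAdd_ofAdd] at h1 h2
  have hc1 := Int.isUnit_iff.mp (IsUnit.of_mul_eq_one_right _ h1.symm)
  have he1 := Int.isUnit_iff.mp (IsUnit.of_mul_eq_one_right _ h2.symm)
  have key : (∀ x, Multiplicative.toAdd (M.artinLength (α x)) =
      Multiplicative.toAdd (M.artinLength x)) ∨ ∀ x, Multiplicative.toAdd (M.artinLength (α x)) =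
      -Multiplicative.toAdd (M.artinLength x) := by
    have he' : ∀ x, Multiplicative.toAdd (M.artinLength (α x)) = n x * e := he
    rcases hc1 with rfl | rfl <;> rcases he1 with rfl | rfl <;> simp [he', hc]
  exact key

end CoxeterMatrix

theorem proposition3p1 {B : Type*} [Finite B] [Nontrivial B] (M : CoxeterMatrix B)
    (hirr : M.IsIrreducible) (hfin : M.IsFiniteType) :
    -- the centre `Z` of `A = A(M)` is infinite cyclic
    (∃ ζ : M.ArtinGroup, Subgroup.zpowers ζ = Subgroup.center M.ArtinGroup ∧
      ¬ IsOfFinOrder ζ) ∧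
    -- the abelianization of `A` is infinite cyclic exactly outside types `I₂(2m)`, `Bₙ`, `F₄`
    (Nonempty (Abelianization M.ArtinGroup ≃* Multiplicative ℤ) ↔
      ¬ ((∃ m : ℕ, 2 ≤ m ∧ M.IsOfType (CoxeterMatrix.I (2 * m - 2))) ∨
        (∃ n : ℕ, 2 ≤ n ∧ M.IsOfType (CoxeterMatrix.B n)) ∨
        M.IsOfType CoxeterMatrix.F₄)) ∧
    -- for any generator `ζ` of `Z`, with `Aut*(A/Z)` defined through `d = ℓ(ζ)`
    ∀ (ζ : M.ArtinGroup) (hζ : Subgroup.zpowers ζ = Subgroup.center M.ArtinGroup),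
      Function.Bijective (M.autStarMap ζ hζ) ∧
      (Nonempty (Abelianization M.ArtinGroup ≃* Multiplicative ℤ) →
        transvectionAut M.ArtinGroup = ⊥ ∧
        ∃ e : MulAut M.ArtinGroup ≃* autStar (M.artinLengthModCenter ζ hζ),
          ∀ α, (e α : MulAut (M.ArtinGroup ⧸ Subgroup.center M.ArtinGroup)) =
            autModCenter M.ArtinGroup α) := by
  have : Finite M.Group := hfin
  refine ⟨?_, CoxeterMatrix.nonempty_abelianization_iff hirr, fun ζ hζ => ?_⟩
  · obtain ⟨ζ, hζ⟩ := CoxeterMatrix.exists_zpowers_eq_center hirr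
    refine ⟨ζ, hζ, fun h => ?_⟩
    obtain ⟨n, hn, h1⟩ := h.exists_pow_eq_one
    have h3 := CoxeterMatrix.three_le_abs_artinLength hirr hζ
    have h2 := congrArg (fun x => Multiplicative.toAdd (M.artinLength x)) h1
    simp only [map_pow, map_one, toAdd_pow, toAdd_one, nsmul_eq_mul,
      mul_eq_zero, Nat.cast_eq_zero, hn.ne', false_or] at h2
    rw [h2] at h3
    norm_num at h3
  · have hd := CoxeterMatrix.three_le_abs_artinLength hirr hζ
    have hbij := CoxeterMatrix.autStarMap_bijective hζ hd
    refine ⟨hbij, fun hab => ?_⟩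
    have htop := CoxeterMatrix.autStar_artinLength_eq_top hab
    have hmem : ∀ α, α ∈ autStar M.artinLength := fun α => htop ▸ Subgroup.mem_top α
    refine ⟨?_, ?_⟩
    · rw [eq_bot_iff]
      rintro α ⟨lam, hlam⟩
      refine CoxeterMatrix.eq_one_of_autModCenter_eq_one hζ hd (hmem α) fun x => ?_
      rw [hlam, eq_comm, QuotientGroup.eq, inv_mul_cancel_left]
      exact (lam x).2
    · refine ⟨((Subgroup.topEquiv.symm.trans (MulEquiv.subgroupCongr htop.symm)).trans
        (MulEquiv.ofBijective (M.autStarMap ζ hζ) hbij)), fun α => rfl⟩
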